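/- Let $C$ be a simple closed contour in the complex plane (piecewise continuously differentiable, with non-vanishing one-sided tangent vectors), taken counter-clockwise; let $D^+$ be the open domain inside $C$ and $D^-$ the open domain outside $C$, and let $f$ be holomorphic on an open set containing $D^+\cup C$. Put $$J[f](z)=\frac{1}{2\pi i}\oint_C\frac{f(t)}{t-z}\,dt,\qquad J_n[f](z)=\frac{d^n}{dz^n}J[f](z)\qquad(z\notin C,\ n=0,1,2,\dots).$$ Then $\overline{D^+}=D^+\cup C$ and $\overline{D^-}=D^-\cup C$, and for every $n\ge 0$ the following hold. (a) $J[f]$ is analytic off $C$, and for every $z\notin C$ and every $0\le m\le n$, $$J_n[f](z)=\frac{(n-m)!}{2\pi i}\oint_C\frac{f^{(m)}(t)}{(t-z)^{n-m+1}}\,dt.$$ (b) $J_n[f](z)-f^{(n)}(z)=0$ for $z\in D^+$, $J_n[f](z)=0$ for $z\in D^-$, and $J_n[f](z)\to 0$ as $|z|\to\infty$. (c) These formulas converge uniformly up to the contour: as $z\in D^+$ tends to $z_0\in C$, $J_n[f](z)\to f^{(n)}(z_0)$ and $J_n[f](z)-f^{(n)}(z)\to 0$, and as $z\in D^-$ tends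 to $z_0\in C$, $J_n[f](z)\to 0$; in each case uniformly in $z_0\in C$, i.e. for every $\varepsilon>0$ there is a $\delta>0$, independent of $z_0\in C$, such that the error is less than $\varepsilon$ whenever $|z-z_0|<\delta$. (d) At every $z_0\in C$ at which $C$ is regular (the two one-sided tangent vectors have the same direction; so at every $z_0\in C$ if $C$ is smooth) the principal value $$P\oint_C\frac{f^{(n)}(t)}{t-z_0}\,dt=\lim_{\epsilon\to0+}\int_{\{t\in C:\ |t-z_0|>\epsilon\}}\frac{f^{(n)}(t)}{t-z_0}\,dt$$ exists, and the common boundary value is $$\lim_{D^+\ni z\to z_0}\bigl(J_n[f](z)-f^{(n)}(z)\bigr)=\lim_{D^-\ni z\to z_0}J_n[f](z)=-\tfrac12 f^{(n)}(z_0)+\frac{1}{2\pi i}P\oint_C\frac{f^{(n)}(t)}{t-z_0}\,dt=0.$$ -/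

import Mathlib

open Set Filter Topology

noncomputable section

namespace CauchyContour

/-- A simple closed contour: a continuous parametrization `γ` of period `1`, injective on one
period, which is continuously differentiable with non-vanishing (one-sided at the ends) derivative
on each of the finitely many pieces `[τ i, τ (i+1)]` of a subdivision of `[0, 1]`. -/
structure IsContour (γ : ℝ → ℂ) : Prop where
  continuous : Continuous γ
  periodic : Function.Periodic γ 1
  injOn : InjOn γ (Ico 0 1)
  piecewise : ∃ (k : ℕ) (τ : ℕ → ℝ), τ 0 = 0 ∧ τ k = 1 ∧ ∀ i < k,
    τ i < τ (i + 1) ∧ ContDiffOn ℝ 1 γ (Icc (τ i) (τ (i + 1))) ∧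
      ∀ s ∈ Icc (τ i) (τ (i + 1)), derivWithin γ (Icc (τ i) (τ (i + 1))) s ≠ 0

/-- The point set `C` of the contour. -/
def trace (γ : ℝ → ℂ) : Set ℂ := γ '' Icc 0 1

/-- The open domain `D⁺` inside the contour: the points of the complement of `C` whose connected
component is bounded. -/
def inside (γ : ℝ → ℂ) : Set ℂ :=
  {z | z ∉ trace γ ∧ Bornology.IsBounded (connectedComponentIn (trace γ)ᶜ z)}

/-- The open domain `D⁻` outside the contour: the points of the complement of `C` whose connected
component is unbounded. -/
def outside (γ : ℝ → ℂ) : Set ℂ :=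
  {z | z ∉ trace γ ∧ ¬ Bornology.IsBounded (connectedComponentIn (trace γ)ᶜ z)}

/-- The contour integral `∮_C g(t) dt`. -/
def contourIntegral (γ : ℝ → ℂ) (g : ℂ → ℂ) : ℂ :=
  ∫ s in (0 : ℝ)..1, g (γ s) * deriv γ s

/-- The winding number `(1/2πi) ∮_C dt/(t - z)`, for `z` off the contour. -/
def windingNumber (γ : ℝ → ℂ) (z : ℂ) : ℂ :=
  1 / (2 * Real.pi * Complex.I) * contourIntegral γ (fun t => 1 / (t - z))

/-- The contour is taken counter-clockwise: it winds once, in the positive sense, around each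
point inside. -/
def PositivelyOriented (γ : ℝ → ℂ) : Prop := ∀ z ∈ inside γ, windingNumber γ z = 1

/-- The Cauchy integral `J[f](z) = (1/2πi) ∮_C f(t)/(t - z) dt`. -/
def cauchyJ (γ : ℝ → ℂ) (f : ℂ → ℂ) (z : ℂ) : ℂ :=
  1 / (2 * Real.pi * Complex.I) * contourIntegral γ (fun t => f t / (t - z))

/-- The derivatives `J_n[f] = dⁿ J[f] / dzⁿ` of the Cauchy integral. -/
def cauchyJn (γ : ℝ → ℂ) (f : ℂ → ℂ) (n : ℕ) (z : ℂ) : ℂ :=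
  iteratedDeriv n (cauchyJ γ f) z

/-- The integrals `J_(n,m)[f](z) = ((n-m)!/2πi) ∮_C f⁽ᵐ⁾(t)/(t - z)^(n-m+1) dt`, used for
`m ≤ n` only. -/
def cauchyJnm (γ : ℝ → ℂ) (f : ℂ → ℂ) (n m : ℕ) (z : ℂ) : ℂ :=
  ((n - m).factorial : ℂ) / (2 * Real.pi * Complex.I) *
    contourIntegral γ (fun t => iteratedDeriv m f t / (t - z) ^ (n - m + 1))

/-- Cauchy's principal value: `P ∮_C g(t)/(t - z₀) dt` exists and equals `L`, that is, the
integrals over the part of the contour with `|t - z₀| > ε` tend to `L` as `ε → 0+`. -/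
def HasPrincipalValue (γ : ℝ → ℂ) (g : ℂ → ℂ) (z₀ L : ℂ) : Prop :=
  Tendsto
    (fun ε : ℝ => ∫ s in (0 : ℝ)..1,
      {s : ℝ | ε < ‖γ s - z₀‖}.indicator (fun s => g (γ s) / (γ s - z₀) * deriv γ s) s)
    (𝓝[>] 0) (𝓝 L)

/-- The contour is regular at `γ s`: it has no corner or cusp there, i.e. the two one-sided
tangent vectors point in the same direction. -/
def HasTangentAt (γ : ℝ → ℂ) (s : ℝ) : Prop :=
  ∃ r : ℝ, 0 < r ∧ derivWithin γ (Ici s) s = (r : ℂ) * derivWithin γ (Iic s) s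

/-- As `z ∈ D` approaches a point `z₀` of `C`, the value `g z` converges to `b z₀`, uniformly in
`z₀ ∈ C`. -/
def ConvergesUniformlyUpTo (D C : Set ℂ) (g b : ℂ → ℂ) : Prop :=
  ∀ ε > 0, ∃ δ > 0, ∀ z₀ ∈ C, ∀ z ∈ D, dist z z₀ < δ → dist (g z) (b z₀) < ε

end CauchyContour

end

/-! Cauchy's formula comes from Dixon's argument, without homotopy or the Jordan curve theorem. The
integral of `dslope f z` over the contour is holomorphic in `z ∈ U`. On `outside γ` it agrees with
the Cauchy integral, because the winding number vanishes there. The two glue to an entire function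
tending to `0` at infinity, which is `0` by Liouville (`contourIntegral_dslope_eq_zero`). Hence the
Cauchy integral is `f` inside, where the winding number is `1`, and `0` outside. The derivatives,
the formulas with `f⁽ᵐ⁾` and the limits up to the contour follow from these identities on open sets
and from uniform continuity on the compact set `inside γ ∪ trace γ`.

The closures and the principal value rest on `IsContour.jump`. At a regular point with unit tangent
`u`, let `z` approach along the two normals `± i u`. Near the point an explicit logarithm is a
primitive of `1 / (t - z)`; the rest of the contour contributes continuously. The two limits of the
winding number differ by `1`, yet both lie in `{0, 1}`, so they are `1` on the left and `0` on the
right. Both domains therefore accumulate at every regular point, and by density at every point of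
the contour.

The same identity evaluates the integral of `1 / (t - z₀)` over the contour minus a short arc: it is
`2πi` minus a difference of logarithms tending to `πi`. Removing a disc instead of a parameter
interval makes no difference in the limit (`tendsto_integral_indicator_sub_integral`), so the
principal value is `πi`. For general `f`, subtracting `f z₀ / (t - z₀)` leaves `dslope f z₀`, whose
integral is `0`. -/

namespace CauchyContour

/-! ### Regularity of the parametrization and topology of the two domains -/

section Regularity

variable {γ : ℝ → ℂ}

theorem exists_mem_Ico_of_subdivision {τ : ℕ → ℝ} {s : ℝ} {k : ℕ} (h0 : τ 0 ≤ s) (hk : s < τ k) :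
    ∃ i < k, s ∈ Ico (τ i) (τ (i + 1)) := by
  induction k with
  | zero => exact absurd hk (not_lt.2 h0)
  | succ k ih =>
    by_cases h : s < τ k
    · obtain ⟨i, hi, hs⟩ := ih h
      exact ⟨i, by omega, hs⟩
    · exact ⟨k, by omega, not_lt.1 h, hk⟩

theorem exists_mem_Ioc_of_subdivision {τ : ℕ → ℝ} {s : ℝ} {k : ℕ} (h0 : τ 0 < s) (hk : s ≤ τ k) :
    ∃ i < k, s ∈ Ioc (τ i) (τ (i + 1)) := by
  induction k with
  | zero => exact absurd hk (not_le.2 h0)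
  | succ k ih =>
    by_cases h : s ≤ τ k
    · obtain ⟨i, hi, hs⟩ := ih h
      exact ⟨i, by omega, hs⟩
    · exact ⟨k, by omega, not_le.1 h, hk⟩

theorem _root_.Function.Periodic.hasDerivWithinAt_Ici (h : Function.Periodic γ 1) {v : ℂ} {s : ℝ}
    (n : ℤ) (hd : HasDerivWithinAt γ v (Ici (s - n)) (s - n)) : HasDerivWithinAt γ v (Ici s) s := by
  have h1 : HasDerivWithinAt (fun x : ℝ => x - n) 1 (Ici s) s :=
    ((hasDerivAt_id s).sub_const (n : ℝ)).hasDerivWithinAt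
  have := hd.scomp s h1 (fun x hx => by simpa using hx)
  rw [one_smul] at this
  exact this.congr (fun x _ => by simpa using (h.sub_int_mul_eq n (x := x)).symm)
    (by simpa using (h.sub_int_mul_eq n (x := s)).symm)

theorem _root_.Function.Periodic.hasDerivWithinAt_Iic (h : Function.Periodic γ 1) {v : ℂ} {s : ℝ}
    (n : ℤ) (hd : HasDerivWithinAt γ v (Iic (s - n)) (s - n)) : HasDerivWithinAt γ v (Iic s) s := by
  have h1 : HasDerivWithinAt (fun x : ℝ => x - n) 1 (Iic s) s :=
    ((hasDerivAt_id s).sub_const (n : ℝ)).hasDerivWithinAt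
  have := hd.scomp s h1 (fun x hx => by simpa using hx)
  rw [one_smul] at this
  exact this.congr (fun x _ => by simpa using (h.sub_int_mul_eq n (x := x)).symm)
    (by simpa using (h.sub_int_mul_eq n (x := s)).symm)

theorem _root_.Function.Periodic.hasDerivAt_of_sub_int (h : Function.Periodic γ 1) {v : ℂ} {s : ℝ}
    (n : ℤ) (hd : HasDerivAt γ v (s - n)) : HasDerivAt γ v s := by
  have h1 : HasDerivAt (fun x : ℝ => x - n) 1 s := (hasDerivAt_id s).sub_const (n : ℝ)
  have := hd.scomp s h1
  rw [one_smul] at this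
  refine this.congr_of_eventuallyEq (Eventually.of_forall fun x => ?_)
  simpa using (h.sub_int_mul_eq n (x := x)).symm

theorem IsContour.exists_hasDerivWithinAt_Ici (hγ : IsContour γ) (s : ℝ) :
    ∃ v ≠ 0, HasDerivWithinAt γ v (Ici s) s := by
  obtain ⟨k, τ, h0, h1, hτ⟩ := hγ.piecewise
  have hs := Int.fract_nonneg s
  have hs' := Int.fract_lt_one s
  obtain ⟨i, hi, his⟩ := exists_mem_Ico_of_subdivision (τ := τ) (k := k) (h0 ▸ hs) (h1 ▸ hs')
  obtain ⟨hlt, hC, hne⟩ := hτ i hi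
  have hmem : Int.fract s ∈ Icc (τ i) (τ (i + 1)) := ⟨his.1, his.2.le⟩
  refine ⟨_, hne _ hmem, hγ.periodic.hasDerivWithinAt_Ici ⌊s⌋ ?_⟩
  exact ((hC.differentiableOn (by norm_num)) _ hmem).hasDerivWithinAt.mono_of_mem_nhdsWithin
    (mem_of_superset (Ico_mem_nhdsGE his.2) fun x hx => ⟨his.1.trans hx.1, hx.2.le⟩)

theorem IsContour.exists_hasDerivWithinAt_Iic (hγ : IsContour γ) (s : ℝ) :
    ∃ v ≠ 0, HasDerivWithinAt γ v (Iic s) s := by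
  obtain ⟨k, τ, h0, h1, hτ⟩ := hγ.piecewise
  -- Subtracting `⌈s⌉ - 1` rather than `⌊s⌋` lands in `(0, 1]`, so a left neighbourhood stays within
  -- one piece even when `s` is an integer.
  have hs : 0 < s - (⌈s⌉ - 1 : ℤ) := by push_cast; linarith [Int.ceil_lt_add_one s]
  have hs' : s - (⌈s⌉ - 1 : ℤ) ≤ 1 := by push_cast; linarith [Int.le_ceil s]
  obtain ⟨i, hi, his⟩ := exists_mem_Ioc_of_subdivision (τ := τ) (k := k) (h0 ▸ hs) (h1 ▸ hs')
  obtain ⟨hlt, hC, hne⟩ := hτ i hi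
  have hmem : s - (⌈s⌉ - 1 : ℤ) ∈ Icc (τ i) (τ (i + 1)) := ⟨his.1.le, his.2⟩
  refine ⟨_, hne _ hmem, hγ.periodic.hasDerivWithinAt_Iic (⌈s⌉ - 1) ?_⟩
  exact ((hC.differentiableOn (by norm_num)) _ hmem).hasDerivWithinAt.mono_of_mem_nhdsWithin
    (mem_of_superset (Ioc_mem_nhdsLE his.1) fun x hx => ⟨hx.1.le, hx.2.trans his.2⟩)

/-- The exceptional set consists of all integer translates of breakpoints. Countability serves
twice: it is null for integration, and its complement is dense in the parameter line. -/
theorem IsContour.exists_countable_hasDerivAt (hγ : IsContour γ) :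
    ∃ (S : Set ℝ) (M : ℝ), S.Countable ∧ ∀ s ∉ S, ∃ v ≠ 0, ‖v‖ ≤ M ∧ HasDerivAt γ v s := by
  obtain ⟨k, τ, h0, h1, hτ⟩ := hγ.piecewise
  have hb : ∀ i : Fin k, ∃ M, ∀ s ∈ Icc (τ i) (τ (i + 1)),
      ‖derivWithin γ (Icc (τ i) (τ (i + 1))) s‖ ≤ M := fun i => by
    obtain ⟨hlt, hC, -⟩ := hτ i i.2
    exact isCompact_Icc.exists_bound_of_continuousOn
      (hC.continuousOn_derivWithin (uniqueDiffOn_Icc hlt) le_rfl)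
  choose M hM using hb
  refine ⟨⋃ (n : ℤ) (i : ℕ), {τ i + n}, ∑ i, |M i|,
    countable_iUnion fun n => countable_iUnion fun i => countable_singleton _, fun s hs => ?_⟩
  have hs0 := Int.fract_nonneg s
  have hs' := Int.fract_lt_one s
  obtain ⟨i, hi, his⟩ := exists_mem_Ico_of_subdivision (τ := τ) (k := k) (h0 ▸ hs0) (h1 ▸ hs')
  have hne' : τ i ≠ Int.fract s := fun h => hs <| by
    simp only [mem_iUnion, mem_singleton_iff]
    exact ⟨⌊s⌋, i, by rw [h, Int.fract_add_floor]⟩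
  have hlt' := lt_of_le_of_ne his.1 hne'
  obtain ⟨hlt, hC, hne⟩ := hτ i hi
  have hmem : Int.fract s ∈ Icc (τ i) (τ (i + 1)) := ⟨his.1, his.2.le⟩
  refine ⟨_, hne _ hmem, ?_, hγ.periodic.hasDerivAt_of_sub_int ⌊s⌋ ?_⟩
  · exact (hM ⟨i, hi⟩ _ hmem).trans ((le_abs_self _).trans
      (Finset.single_le_sum (f := fun i => |M i|) (fun _ _ => abs_nonneg _) (Finset.mem_univ _)))
  · exact ((hC.differentiableOn (by norm_num)) _ hmem).hasDerivWithinAt.hasDerivAt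
      (Icc_mem_nhds hlt' his.2)

theorem IsContour.exists_ae_norm_deriv_le (hγ : IsContour γ) :
    ∃ M, 0 < M ∧ ∀ᵐ s, ‖deriv γ s‖ ≤ M := by
  obtain ⟨S, M, hS, h⟩ := hγ.exists_countable_hasDerivAt
  refine ⟨max M 1, by positivity, ?_⟩
  filter_upwards [hS.ae_notMem MeasureTheory.volume] with s hs
  obtain ⟨v, -, hv, hd⟩ := h s hs
  rw [hd.deriv]
  exact hv.trans (le_max_left _ _)

theorem IsContour.intervalIntegrable_deriv (hγ : IsContour γ) (a b : ℝ) :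
    IntervalIntegrable (deriv γ) MeasureTheory.volume a b := by
  obtain ⟨M, -, hM⟩ := hγ.exists_ae_norm_deriv_le
  exact (intervalIntegrable_const (c := M)).mono_fun
    (measurable_deriv γ).aestronglyMeasurable
    (MeasureTheory.ae_restrict_of_ae (hM.mono fun s hs => hs.trans (le_abs_self _)))

theorem IsContour.intervalIntegrable_mul_deriv (hγ : IsContour γ) {φ : ℝ → ℂ} {a b : ℝ}
    (hφ : ContinuousOn φ (uIcc a b)) :
    IntervalIntegrable (fun s => φ s * deriv γ s) MeasureTheory.volume a b :=
  (hγ.intervalIntegrable_deriv a b).continuousOn_mul hφ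

/-- Corners are harmless: the fundamental theorem of calculus tolerates countably many points of
non-differentiability of a continuous primitive. -/
theorem IsContour.integral_comp_mul_deriv (hγ : IsContour γ) {F F' : ℂ → ℂ} {a b : ℝ} (hab : a ≤ b)
    (hF : ∀ s ∈ Icc a b, HasDerivAt F (F' (γ s)) (γ s))
    (hF' : ContinuousOn (fun s => F' (γ s)) (Icc a b)) :
    ∫ s in a..b, F' (γ s) * deriv γ s = F (γ b) - F (γ a) := by
  obtain ⟨S, M, hS, h⟩ := hγ.exists_countable_hasDerivAt
  refine MeasureTheory.integral_eq_of_hasDerivAt_off_countable_of_le (fun s => F (γ s)) _ hab hS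
    ?_ ?_ ?_
  · exact fun s hs => ((hF s hs).continuousAt.comp (f := γ)
      hγ.continuous.continuousAt).continuousWithinAt
  · intro s hs
    obtain ⟨v, -, -, hv⟩ := h s hs.2
    rw [hv.deriv]
    exact (hF s (Ioo_subset_Icc_self hs.1)).comp s hv
  · exact hγ.intervalIntegrable_mul_deriv (by rwa [uIcc_of_le hab])

theorem IsContour.eq_add_int (hγ : IsContour γ) {s t : ℝ} (h : γ s = γ t) :
    ∃ n : ℤ, s = t + n := by
  have hf : ∀ x : ℝ, γ (Int.fract x) = γ x := fun x => by
    simpa using hγ.periodic.sub_int_mul_eq ⌊x⌋ (x := x)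
  have := hγ.injOn ⟨Int.fract_nonneg s, Int.fract_lt_one s⟩ ⟨Int.fract_nonneg t, Int.fract_lt_one t⟩
    (by rw [hf, hf, h])
  refine ⟨⌊s⌋ - ⌊t⌋, ?_⟩
  push_cast
  linarith [Int.fract_add_floor s, Int.fract_add_floor t]

theorem IsContour.mem_trace (hγ : IsContour γ) (s : ℝ) : γ s ∈ trace γ :=
  ⟨Int.fract s, ⟨Int.fract_nonneg s, (Int.fract_lt_one s).le⟩, by
    simpa using hγ.periodic.sub_int_mul_eq ⌊s⌋ (x := s)⟩

theorem IsContour.isCompact_trace (hγ : IsContour γ) : IsCompact (trace γ) :=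
  isCompact_Icc.image hγ.continuous

theorem IsContour.isOpen_compl_trace (hγ : IsContour γ) : IsOpen (trace γ)ᶜ :=
  hγ.isCompact_trace.isClosed.isOpen_compl

theorem IsContour.continuousOn_comp (hγ : IsContour γ) {g : ℂ → ℂ} (hg : ContinuousOn g (trace γ))
    (s : Set ℝ) : ContinuousOn (fun t => g (γ t)) s :=
  (hg.comp_continuous hγ.continuous hγ.mem_trace).continuousOn

theorem IsContour.exists_trace_subset_closedBall (hγ : IsContour γ) :
    ∃ R, 0 < R ∧ trace γ ⊆ Metric.closedBall 0 R :=
  (hγ.isCompact_trace.isBounded.subset_closedBall_lt 0 0)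

theorem hasTangentAt_of_hasDerivAt {v : ℂ} {s : ℝ} (h : HasDerivAt γ v s) :
    HasTangentAt γ s :=
  ⟨1, one_pos, by
    rw [h.hasDerivWithinAt.derivWithin (uniqueDiffOn_Ici s s self_mem_Ici),
      h.hasDerivWithinAt.derivWithin (uniqueDiffOn_Iic s s self_mem_Iic)]; simp⟩

theorem mem_inside_or_mem_outside {z : ℂ} (hz : z ∉ trace γ) : z ∈ inside γ ∨ z ∈ outside γ := by
  by_cases h : Bornology.IsBounded (connectedComponentIn (trace γ)ᶜ z)
  · exact Or.inl ⟨hz, h⟩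
  · exact Or.inr ⟨hz, h⟩

theorem IsContour.isOpen_inside (hγ : IsContour γ) : IsOpen (inside γ) := by
  rw [isOpen_iff_mem_nhds]
  intro z hz
  refine mem_of_superset (hγ.isOpen_compl_trace.connectedComponentIn.mem_nhds
    (mem_connectedComponentIn (F := (trace γ)ᶜ) hz.1)) fun y hy => ?_
  refine ⟨connectedComponentIn_subset _ _ hy, ?_⟩
  rw [← connectedComponentIn_eq hy]
  exact hz.2

theorem IsContour.isOpen_outside (hγ : IsContour γ) : IsOpen (outside γ) := by
  rw [isOpen_iff_mem_nhds]
  intro z hz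
  refine mem_of_superset (hγ.isOpen_compl_trace.connectedComponentIn.mem_nhds
    (mem_connectedComponentIn (F := (trace γ)ᶜ) hz.1)) fun y hy => ?_
  refine ⟨connectedComponentIn_subset _ _ hy, ?_⟩
  rw [← connectedComponentIn_eq hy]
  exact hz.2

/-- The radial ray from `z` to infinity avoids the contour, so it lies in the component of `z` and
makes it unbounded. -/
theorem mem_outside_of_norm_lt {R : ℝ} (hR : 0 < R) (hsub : trace γ ⊆ Metric.closedBall 0 R) {z : ℂ}
    (hz : R < ‖z‖) : z ∈ outside γ := by
  have hmem : ∀ x : ℝ, 1 ≤ x → (x : ℂ) * z ∈ (trace γ)ᶜ := fun x hx h => by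
    have h1 := hsub h
    rw [mem_closedBall_zero_iff, norm_mul, Complex.norm_real, Real.norm_of_nonneg (by linarith)]
      at h1
    nlinarith
  have hz1 : z ∉ trace γ := by simpa using hmem 1 le_rfl
  refine ⟨hz1, fun hb => ?_⟩
  have hsubset : (fun x : ℝ => (x : ℂ) * z) '' Ici 1 ⊆ connectedComponentIn (trace γ)ᶜ z := by
    refine IsPreconnected.subset_connectedComponentIn ?_ ⟨1, self_mem_Ici, by simp⟩ ?_
    · exact isPreconnected_Ici.image _ (by fun_prop)
    · rintro _ ⟨x, hx, rfl⟩
      exact hmem x hx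
  obtain ⟨B, hB⟩ := (hb.subset hsubset).exists_norm_le
  have h1 := hB _ ⟨max 1 ((B + 1) / R), mem_Ici.2 (le_max_left _ _), rfl⟩
  dsimp only at h1
  rw [norm_mul, Complex.norm_real, Real.norm_of_nonneg (by positivity)] at h1
  have h2 : (B + 1) / R ≤ max 1 ((B + 1) / R) := le_max_right _ _
  have h3 : B + 1 ≤ max 1 ((B + 1) / R) * R := by
    rwa [div_le_iff₀ hR] at h2
  have h4 : 0 < max 1 ((B + 1) / R) := by positivity
  nlinarith

theorem IsContour.isBounded_inside (hγ : IsContour γ) : Bornology.IsBounded (inside γ) := by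
  obtain ⟨R, hR, hsub⟩ := hγ.exists_trace_subset_closedBall
  refine Metric.isBounded_closedBall (x := (0 : ℂ)) (r := R) |>.subset fun z hz => ?_
  by_contra h
  rw [mem_closedBall_zero_iff, not_le] at h
  exact (mem_outside_of_norm_lt hR hsub h).2 hz.2

theorem compl_outside : (outside γ)ᶜ = inside γ ∪ trace γ := by
  ext z
  simp only [inside, outside, mem_compl_iff, mem_ofPred_eq, mem_union]
  tauto

theorem compl_inside : (inside γ)ᶜ = outside γ ∪ trace γ := by
  ext z
  simp only [inside, outside, mem_compl_iff, mem_ofPred_eq, mem_union]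
  tauto

end Regularity

/-! ### Holomorphic dependence of integrals on a parameter -/

/-- For holomorphic integrands a bound on the values suffices: Cauchy's estimate on circles of
radius `r / 4` dominates the derivative, and its measurability in `s` comes from difference
quotients along a sequence. -/
theorem hasDerivAt_intervalIntegral_of_norm_le {F : ℂ → ℝ → ℂ} {z₀ : ℂ} {r B a b : ℝ} (hr : 0 < r)
    (hmeas : ∀ z ∈ Metric.ball z₀ r, MeasureTheory.AEStronglyMeasurable (F z)
      (MeasureTheory.volume.restrict (uIoc a b)))
    (hdiff : ∀ᵐ s, s ∈ uIoc a b → DifferentiableOn ℂ (fun z => F z s) (Metric.ball z₀ r))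
    (hB : ∀ᵐ s, s ∈ uIoc a b → ∀ z ∈ Metric.ball z₀ r, ‖F z s‖ ≤ B) :
    HasDerivAt (fun z => ∫ s in a..b, F z s) (∫ s in a..b, deriv (fun z => F z s) z₀) z₀ := by
  have hz₀ : z₀ ∈ Metric.ball z₀ r := Metric.mem_ball_self hr
  have hslope : MeasureTheory.AEStronglyMeasurable (fun s => deriv (fun z => F z s) z₀)
      (MeasureTheory.volume.restrict (uIoc a b)) := by
    set u : ℕ → ℂ := fun n => z₀ + ((r / 2 * (1 / ((n : ℝ) + 1)) : ℝ) : ℂ) with hu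
    have hpos : ∀ n : ℕ, 0 < r / 2 * (1 / ((n : ℝ) + 1)) := fun n => by positivity
    have hmem : ∀ n, u n ∈ Metric.ball z₀ r := fun n => by
      have h1 : 1 / ((n : ℝ) + 1) ≤ 1 := by
        rw [div_le_one (by positivity)]; linarith [n.cast_nonneg (α := ℝ)]
      rw [Metric.mem_ball, dist_eq_norm, hu, add_sub_cancel_left, Complex.norm_real,
        Real.norm_of_nonneg (hpos n).le]
      nlinarith
    have hlim : Tendsto u atTop (𝓝[≠] z₀) := by
      refine tendsto_nhdsWithin_iff.2 ⟨?_, Eventually.of_forall fun n h => ?_⟩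
      · have := (tendsto_one_div_add_atTop_nhds_zero_nat (𝕜 := ℝ)).const_mul (r / 2)
        rw [mul_zero] at this
        have h1 := ((Complex.continuous_ofReal.tendsto 0).comp this).const_add z₀
        rwa [Complex.ofReal_zero, add_zero] at h1
      · have h1 : ((r / 2 * (1 / ((n : ℝ) + 1)) : ℝ) : ℂ) = 0 := by
          simpa only [hu, mem_singleton_iff, add_eq_left] using h
        exact (hpos n).ne' (Complex.ofReal_eq_zero.1 h1)
    refine aestronglyMeasurable_of_tendsto_ae atTop
      (f := fun n s => slope (fun z => F z s) z₀ (u n)) (fun n => ?_) ?_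
    · simp only [slope_def_module]
      exact ((hmeas _ (hmem n)).sub (hmeas _ hz₀)).const_smul ((u n - z₀)⁻¹)
    · rw [MeasureTheory.ae_restrict_iff' measurableSet_uIoc]
      filter_upwards [hdiff] with s hs hsmem
      exact (((hs hsmem).differentiableAt (Metric.ball_mem_nhds _ hr)).hasDerivAt.tendsto_slope).comp
        hlim
  refine (intervalIntegral.hasDerivAt_integral_of_dominated_loc_of_deriv_le
    (F' := fun z s => deriv (fun z => F z s) z) (bound := fun _ => B / (r / 4))
    (Metric.ball_mem_nhds z₀ (half_pos hr)) ?_ ?_ hslope ?_ intervalIntegrable_const ?_).2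
  · filter_upwards [Metric.ball_mem_nhds z₀ hr] with z hz using hmeas z hz
  · refine (intervalIntegrable_const (c := B)).mono_fun (hmeas _ hz₀) ?_
    refine (MeasureTheory.ae_restrict_iff' measurableSet_uIoc).2 (hB.mono fun s hs hm => ?_)
    exact (hs hm z₀ hz₀).trans (le_abs_self _)
  · filter_upwards [hdiff, hB] with s hs hb hm z hz
    have hsub : Metric.closedBall z (r / 4) ⊆ Metric.ball z₀ r := fun y hy => by
      rw [Metric.mem_ball] at hz ⊢
      rw [Metric.mem_closedBall] at hy
      linarith [dist_triangle y z z₀]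
    refine Complex.norm_deriv_le_of_forall_mem_sphere_norm_le (by positivity) ?_
      fun y hy => hb hm y (hsub (Metric.sphere_subset_closedBall hy))
    exact ((hs hm).mono hsub).diffContOnCl_ball subset_rfl
  · filter_upwards [hdiff] with s hs hm z hz
    exact ((hs hm).differentiableAt (Metric.isOpen_ball.mem_nhds
      (Metric.ball_subset_ball (by linarith) hz))).hasDerivAt

variable {γ : ℝ → ℂ}

theorem IsContour.hasDerivAt_contourIntegral_div_pow (hγ : IsContour γ) {g : ℂ → ℂ}
    (hg : ContinuousOn g (trace γ)) (k : ℕ) {z : ℂ} (hz : z ∉ trace γ) :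
    HasDerivAt (fun w => contourIntegral γ fun t => g t / (t - w) ^ (k + 1))
      ((k + 1) * contourIntegral γ fun t => g t / (t - z) ^ (k + 2)) z := by
  obtain ⟨M, hM0, hM⟩ := hγ.exists_ae_norm_deriv_le
  obtain ⟨G, hG⟩ := hγ.isCompact_trace.exists_bound_of_continuousOn hg
  obtain ⟨r, hr, hball⟩ := Metric.isOpen_iff.1 hγ.isOpen_compl_trace z hz
  have hne : ∀ s, ∀ w ∈ Metric.ball z r, γ s - w ≠ 0 := fun s w hw h =>
    hball hw (sub_eq_zero.1 h ▸ hγ.mem_trace s)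
  have hdist : ∀ s, ∀ w ∈ Metric.ball z (r / 2), r / 2 ≤ ‖γ s - w‖ := fun s w hw => by
    have h1 : r ≤ dist (γ s) z := not_lt.1 fun h => hball (Metric.mem_ball.2 h) (hγ.mem_trace s)
    rw [Metric.mem_ball] at hw
    rw [← dist_eq_norm]
    linarith [dist_triangle (γ s) w z]
  have hsub : Metric.ball z (r / 2) ⊆ Metric.ball z r := Metric.ball_subset_ball (by linarith)
  have hderiv : ∀ s, ∀ w ∈ Metric.ball z r, HasDerivAt
      (fun w => g (γ s) / (γ s - w) ^ (k + 1) * deriv γ s)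
      ((k + 1) * (g (γ s) / (γ s - w) ^ (k + 2) * deriv γ s)) w := fun s w hw => by
    have h1 := ((((hasDerivAt_id w).const_sub (γ s)).fun_pow (k + 1)).fun_inv
      (pow_ne_zero _ (hne s w hw))).const_mul (g (γ s)) |>.mul_const (deriv γ s)
    refine h1.congr_deriv ?_
    have := hne s w hw
    simp only [id, Nat.add_sub_cancel]
    push_cast
    field_simp
    ring
  have key := hasDerivAt_intervalIntegral_of_norm_le (a := 0) (b := 1)
    (F := fun w s => g (γ s) / (γ s - w) ^ (k + 1) * deriv γ s) (z₀ := z) (r := r / 2)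
    (B := G / (r / 2) ^ (k + 1) * M) (half_pos hr) ?_ ?_ ?_
  · refine key.congr_deriv ?_
    rw [contourIntegral, ← intervalIntegral.integral_const_mul]
    congr 1
    ext s
    rw [(hderiv s z (Metric.mem_ball_self hr)).deriv]
  · intro w hw
    refine (hγ.intervalIntegrable_mul_deriv (a := 0) (b := 1) ?_).aestronglyMeasurable_restrict_uIoc
    exact (hγ.continuousOn_comp hg _).div ((hγ.continuous.sub continuous_const).pow _).continuousOn
      fun s _ => pow_ne_zero _ (hne s w (hsub hw))
  · exact Eventually.of_forall fun s _ w hw =>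
      (hderiv s w (hsub hw)).differentiableAt.differentiableWithinAt
  · filter_upwards [hM] with s hs _ w hw
    have hG0 : 0 ≤ G := (norm_nonneg _).trans (hG _ (hγ.mem_trace s))
    rw [norm_mul, norm_div, norm_pow]
    gcongr
    · exact hG _ (hγ.mem_trace s)
    · exact hdist s w hw

theorem IsContour.cauchyJn_eq (hγ : IsContour γ) {g : ℂ → ℂ} (hg : ContinuousOn g (trace γ))
    (n : ℕ) {z : ℂ} (hz : z ∉ trace γ) :
    cauchyJn γ g n z = (n.factorial : ℂ) / (2 * Real.pi * Complex.I) *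
      contourIntegral γ fun t => g t / (t - z) ^ (n + 1) := by
  induction n generalizing z with
  | zero => simp [cauchyJn, cauchyJ]
  | succ n ih =>
    rw [cauchyJn, iteratedDeriv_succ]
    have h1 : iteratedDeriv n (cauchyJ γ g) =ᶠ[𝓝 z] fun w =>
        (n.factorial : ℂ) / (2 * Real.pi * Complex.I) *
          contourIntegral γ fun t => g t / (t - w) ^ (n + 1) := by
      filter_upwards [hγ.isOpen_compl_trace.mem_nhds hz] with w hw using ih hw
    rw [h1.deriv_eq, ((hγ.hasDerivAt_contourIntegral_div_pow hg n hz).const_mul _).deriv,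
      Nat.factorial_succ]
    push_cast
    ring

theorem IsContour.hasDerivAt_cauchyJ (hγ : IsContour γ) {g : ℂ → ℂ} (hg : ContinuousOn g (trace γ))
    {z : ℂ} (hz : z ∉ trace γ) : HasDerivAt (cauchyJ γ g)
      (1 / (2 * Real.pi * Complex.I) * contourIntegral γ fun t => g t / (t - z) ^ 2) z := by
  have := (hγ.hasDerivAt_contourIntegral_div_pow hg 0 hz).const_mul (1 / (2 * Real.pi * Complex.I))
  simp only [zero_add, pow_one, Nat.cast_zero, one_mul] at this
  exact this

theorem IsContour.analyticAt_cauchyJ (hγ : IsContour γ) {g : ℂ → ℂ}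
    (hg : ContinuousOn g (trace γ)) {z : ℂ} (hz : z ∉ trace γ) : AnalyticAt ℂ (cauchyJ γ g) z :=
  DifferentiableOn.analyticAt (s := (trace γ)ᶜ)
    (fun _ hw => (hγ.hasDerivAt_cauchyJ hg hw).differentiableAt.differentiableWithinAt)
    (hγ.isOpen_compl_trace.mem_nhds hz)

/-! ### Behaviour at infinity and the winding number outside -/

theorem IsContour.tendsto_contourIntegral_cobounded (hγ : IsContour γ) {g : ℂ → ℂ}
    (hg : ContinuousOn g (trace γ)) :
    Tendsto (fun z => contourIntegral γ fun t => g t / (t - z)) (Bornology.cobounded ℂ) (𝓝 0) := by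
  obtain ⟨M, hM0, hM⟩ := hγ.exists_ae_norm_deriv_le
  obtain ⟨G, hG⟩ := hγ.isCompact_trace.exists_bound_of_continuousOn hg
  obtain ⟨R, hR, hsub⟩ := hγ.exists_trace_subset_closedBall
  have hG0 : 0 ≤ G := (norm_nonneg _).trans (hG _ (hγ.mem_trace 0))
  have hbound : ∀ᶠ z in Bornology.cobounded ℂ,
      ‖contourIntegral γ fun t => g t / (t - z)‖ ≤ G * M / (‖z‖ - R) := by
    filter_upwards [tendsto_norm_cobounded_atTop.eventually_gt_atTop R] with z hz
    have h1 : ‖contourIntegral γ fun t => g t / (t - z)‖ ≤ G / (‖z‖ - R) * M * |1 - 0| := by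
      refine intervalIntegral.norm_integral_le_of_norm_le_const_ae ?_
      filter_upwards [hM] with s hs _
      have h2 := hsub (hγ.mem_trace s)
      rw [mem_closedBall_zero_iff] at h2
      have h3 : 0 < ‖z‖ - R := by linarith
      rw [norm_mul, norm_div]
      gcongr
      · exact hG _ (hγ.mem_trace s)
      · rw [norm_sub_rev]
        linarith [norm_sub_norm_le z (γ s)]
    refine h1.trans_eq ?_
    simp only [sub_zero, abs_one]
    ring
  refine squeeze_zero_norm' hbound ?_
  exact Tendsto.div_atTop tendsto_const_nhds
    (tendsto_atTop_add_const_right _ _ tendsto_norm_cobounded_atTop)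

theorem IsContour.contourIntegral_inv_sq_eq_zero (hγ : IsContour γ) {z : ℂ} (hz : z ∉ trace γ) :
    contourIntegral γ (fun t => 1 / (t - z) ^ 2) = 0 := by
  have hne : ∀ s, γ s - z ≠ 0 := fun s h => hz (sub_eq_zero.1 h ▸ hγ.mem_trace s)
  rw [contourIntegral, hγ.integral_comp_mul_deriv (F := fun t => -(t - z)⁻¹)
    (F' := fun t => 1 / (t - z) ^ 2) zero_le_one]
  · have := hγ.periodic 0
    rw [zero_add] at this
    rw [this, sub_self]
  · intro s _
    have := (((hasDerivAt_id (γ s)).sub_const z).fun_inv (hne s)).fun_neg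
    simpa [id, neg_div] using this
  · exact continuousOn_const.div ((hγ.continuous.sub continuous_const).pow _).continuousOn
      fun s _ => pow_ne_zero _ (hne s)

/-- The derivative of the winding number integrates `1 / (t - z)²`, which has a primitive, around a
closed curve. So the winding number is constant on the component of `z`, which reaches infinity,
where the limit is `0`. -/
theorem IsContour.windingNumber_eq_zero (hγ : IsContour γ) {z : ℂ} (hz : z ∈ outside γ) :
    windingNumber γ z = 0 := by
  set D := connectedComponentIn (trace γ)ᶜ z with hD
  have hDsub : D ⊆ (trace γ)ᶜ := connectedComponentIn_subset _ _
  have hDopen : IsOpen D := hγ.isOpen_compl_trace.connectedComponentIn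
  have hderiv : ∀ w ∈ D, HasDerivAt (windingNumber γ) 0 w := fun w hw => by
    have := hγ.hasDerivAt_cauchyJ (g := fun _ => 1) continuousOn_const (hDsub hw)
    rwa [hγ.contourIntegral_inv_sq_eq_zero (hDsub hw), mul_zero] at this
  have hconst : ∀ w ∈ D, windingNumber γ w = windingNumber γ z := fun w hw =>
    hDopen.is_const_of_deriv_eq_zero isPreconnected_connectedComponentIn
      (fun w hw => (hderiv w hw).differentiableAt.differentiableWithinAt)
      (fun w hw => (hderiv w hw).deriv) hw
      (mem_connectedComponentIn (F := (trace γ)ᶜ) hz.1)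
  have hlim : Tendsto (windingNumber γ) (Bornology.cobounded ℂ) (𝓝 0) := by
    have := (hγ.tendsto_contourIntegral_cobounded (g := fun _ => 1) continuousOn_const).const_mul
      (1 / (2 * Real.pi * Complex.I))
    rwa [mul_zero] at this
  have hfreq : ∃ᶠ w in Bornology.cobounded ℂ, w ∈ D := fun h => hz.2 <| by
    have h1 : Dᶜ ∈ Bornology.cobounded ℂ := h
    rwa [← Bornology.isCobounded_def, Bornology.isCobounded_compl_iff] at h1
  have hfr : (Bornology.cobounded ℂ ⊓ 𝓟 D).NeBot := frequently_mem_iff_neBot.1 hfreq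
  refine tendsto_nhds_unique (tendsto_const_nhds.congr' ?_) (hlim.mono_left inf_le_left)
    (l := Bornology.cobounded ℂ ⊓ 𝓟 D)
  filter_upwards [mem_inf_of_right (mem_principal_self D)] with w hw using (hconst w hw).symm

/-! ### Cauchy's formula by Dixon's argument -/

theorem dslope_comm {𝕜 E : Type*} [NontriviallyNormedField 𝕜] [NormedAddCommGroup E]
    [NormedSpace 𝕜 E] (f : 𝕜 → E) (a b : 𝕜) : dslope f a b = dslope f b a := by
  rcases eq_or_ne a b with rfl | h
  · rfl
  · rw [dslope_of_ne _ h.symm, dslope_of_ne _ h, slope_comm]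

variable {U : Set ℂ} {f : ℂ → ℂ}

theorem continuousOn_dslope_of_isOpen (hU : IsOpen U) (hf : DifferentiableOn ℂ f U) {z : ℂ}
    (hz : z ∈ U) : ContinuousOn (dslope f z) U :=
  ((Complex.differentiableOn_dslope (hU.mem_nhds hz)).2 hf).continuousOn

/-- Symmetry of `dslope` gives holomorphy in `z` for each fixed point of the contour, even where the
two coincide. The uniform bound uses the mean value inequality for contour points near `z₀`, and a
denominator of size at least `r` for the others. -/
theorem IsContour.differentiableAt_integral_dslope (hγ : IsContour γ) (hU : IsOpen U)
    (hsub : trace γ ⊆ U) (hf : DifferentiableOn ℂ f U) {z₀ : ℂ} (hz₀ : z₀ ∈ U) :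
    DifferentiableAt ℂ (fun z => contourIntegral γ (dslope f z)) z₀ := by
  obtain ⟨M, hM0, hM⟩ := hγ.exists_ae_norm_deriv_le
  obtain ⟨G, hG⟩ := hγ.isCompact_trace.exists_bound_of_continuousOn (hf.continuousOn.mono hsub)
  have hG0 : 0 ≤ G := (norm_nonneg _).trans (hG _ (hγ.mem_trace 0))
  obtain ⟨ρ, hρ, hball⟩ := Metric.isOpen_iff.1 hU z₀ hz₀
  set r := ρ / 3 with hr_def
  have hr : 0 < r := by positivity
  have hK : Metric.closedBall z₀ (2 * r) ⊆ U :=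
    (Metric.closedBall_subset_ball (by linarith)).trans hball
  have hrK : Metric.ball z₀ r ⊆ Metric.closedBall z₀ (2 * r) :=
    Metric.ball_subset_closedBall.trans (Metric.closedBall_subset_closedBall (by linarith))
  obtain ⟨D, hD⟩ := (isCompact_closedBall z₀ (2 * r)).exists_bound_of_continuousOn
    ((hf.deriv hU).continuousOn.mono hK)
  obtain ⟨G', hG'⟩ := (isCompact_closedBall z₀ (2 * r)).exists_bound_of_continuousOn
    (hf.continuousOn.mono hK)
  have hc : z₀ ∈ Metric.closedBall z₀ (2 * r) := Metric.mem_closedBall_self (by positivity)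
  have hD0 : 0 ≤ D := (norm_nonneg _).trans (hD _ hc)
  have hG'0 : 0 ≤ G' := (norm_nonneg _).trans (hG' _ hc)
  have hbound : ∀ s, ∀ z ∈ Metric.ball z₀ r, ‖dslope f z (γ s)‖ ≤ D + (G + G') / r := by
    intro s z hz
    have h0 : 0 ≤ (G + G') / r := by positivity
    rcases eq_or_ne (γ s) z with h | h
    · rw [h, dslope_same]
      linarith [hD z (hrK hz)]
    · rw [dslope_of_ne _ h, slope_def_module, norm_smul, norm_inv, inv_mul_eq_div]
      by_cases hs : γ s ∈ Metric.closedBall z₀ (2 * r)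
      · have h1 := (convex_closedBall z₀ (2 * r)).norm_image_sub_le_of_norm_deriv_le
          (fun x hx => hf.differentiableAt (hU.mem_nhds (hK hx))) hD (hrK hz) hs
        rw [div_le_iff₀ (norm_pos_iff.2 (sub_ne_zero.2 h))]
        exact h1.trans (by gcongr; linarith)
      · have h1 : r ≤ ‖γ s - z‖ := by
          rw [Metric.mem_closedBall, not_le] at hs
          rw [Metric.mem_ball] at hz
          rw [← dist_eq_norm]
          linarith [dist_triangle (γ s) z z₀]
        have h2 : ‖f (γ s) - f z‖ ≤ G + G' :=
          (norm_sub_le _ _).trans (add_le_add (hG _ (hγ.mem_trace s)) (hG' _ (hrK hz)))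
        have h3 : ‖f (γ s) - f z‖ / ‖γ s - z‖ ≤ (G + G') / r := by gcongr
        linarith
  refine (hasDerivAt_intervalIntegral_of_norm_le (a := 0) (b := 1)
    (F := fun z s => dslope f z (γ s) * deriv γ s) (r := r)
    (B := (D + (G + G') / r) * M) hr ?_ ?_ ?_).differentiableAt
  · intro z hz
    refine (hγ.intervalIntegrable_mul_deriv (a := 0) (b := 1) ?_).aestronglyMeasurable_restrict_uIoc
    exact hγ.continuousOn_comp ((continuousOn_dslope_of_isOpen hU hf (hK (hrK hz))).mono hsub) _
  · refine Eventually.of_forall fun s _ => ?_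
    simp only [fun z => dslope_comm f z (γ s)]
    exact (((Complex.differentiableOn_dslope (hU.mem_nhds (hsub (hγ.mem_trace s)))).2 hf).mono
      (hrK.trans hK)).mul_const _
  · filter_upwards [hM] with s hs _ z hz
    rw [norm_mul]
    gcongr
    exact hbound s z hz

theorem IsContour.contourIntegral_sub (hγ : IsContour γ) {g h : ℂ → ℂ}
    (hg : ContinuousOn g (trace γ)) (hh : ContinuousOn h (trace γ)) :
    contourIntegral γ (fun t => g t - h t) = contourIntegral γ g - contourIntegral γ h := by
  simp only [contourIntegral, sub_mul]
  exact intervalIntegral.integral_sub (hγ.intervalIntegrable_mul_deriv (hγ.continuousOn_comp hg _))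
    (hγ.intervalIntegrable_mul_deriv (hγ.continuousOn_comp hh _))

theorem contourIntegral_const_mul (c : ℂ) (g : ℂ → ℂ) :
    contourIntegral γ (fun t => c * g t) = c * contourIntegral γ g := by
  simp only [contourIntegral, mul_assoc]
  exact intervalIntegral.integral_const_mul _ _

theorem continuousOn_div_sub {g : ℂ → ℂ} (hg : ContinuousOn g (trace γ)) {z : ℂ}
    (hz : z ∉ trace γ) : ContinuousOn (fun t => g t / (t - z)) (trace γ) :=
  hg.div (continuousOn_id.sub continuousOn_const) fun _ ht h => hz (sub_eq_zero.1 h ▸ ht)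

theorem IsContour.contourIntegral_dslope (hγ : IsContour γ) (hf : ContinuousOn f (trace γ)) {z : ℂ}
    (hz : z ∉ trace γ) :
    contourIntegral γ (dslope f z) = contourIntegral γ (fun t => f t / (t - z)) -
      f z * contourIntegral γ (fun t => 1 / (t - z)) := by
  rw [← contourIntegral_const_mul, ← hγ.contourIntegral_sub (h := fun t => f z * (1 / (t - z)))
    (continuousOn_div_sub hf hz) (continuousOn_const.mul (continuousOn_div_sub continuousOn_const hz))]
  unfold contourIntegral
  congr 1
  ext s
  have hne : γ s ≠ z := fun h => hz (h ▸ hγ.mem_trace s)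
  rw [dslope_of_ne _ hne, slope_def_field]
  ring

theorem IsContour.contourIntegral_inv_eq_zero (hγ : IsContour γ) {z : ℂ} (hz : z ∈ outside γ) :
    contourIntegral γ (fun t => 1 / (t - z)) = 0 := by
  have h := hγ.windingNumber_eq_zero hz
  rw [windingNumber, mul_eq_zero] at h
  exact h.resolve_left (one_div_ne_zero Complex.two_pi_I_ne_zero)

/-- The first conclusion includes `z` on the contour itself, as needed later for principal values.
-/
theorem IsContour.contourIntegral_dslope_eq_zero (hγ : IsContour γ) (hU : IsOpen U)
    (hsub : inside γ ∪ trace γ ⊆ U) (hf : DifferentiableOn ℂ f U) :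
    (∀ z ∈ U, contourIntegral γ (dslope f z) = 0) ∧
      ∀ z ∈ outside γ, contourIntegral γ (fun t => f t / (t - z)) = 0 := by
  classical
  have htr : trace γ ⊆ U := subset_union_right.trans hsub
  have hfc : ContinuousOn f (trace γ) := hf.continuousOn.mono htr
  have hcover : ∀ z, z ∉ U → z ∈ outside γ := fun z hz => by
    by_contra h
    have : z ∈ (outside γ)ᶜ := h
    rw [compl_outside] at this
    exact hz (hsub this)
  set h : ℂ → ℂ := fun z => if z ∈ U then contourIntegral γ (dslope f z)
    else contourIntegral γ (fun t => f t / (t - z)) with hh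
  have hin : ∀ z ∈ U, h z = contourIntegral γ (dslope f z) := fun z hz => if_pos hz
  have hout : ∀ z ∈ outside γ, h z = contourIntegral γ (fun t => f t / (t - z)) := fun z hz => by
    by_cases hzU : z ∈ U
    · rw [hin z hzU, hγ.contourIntegral_dslope hfc hz.1, hγ.contourIntegral_inv_eq_zero hz,
        mul_zero, sub_zero]
    · exact if_neg hzU
  have hdiff : Differentiable ℂ h := fun z => by
    by_cases hz : z ∈ U
    · refine (hγ.differentiableAt_integral_dslope hU htr hf hz).congr_of_eventuallyEq ?_
      filter_upwards [hU.mem_nhds hz] with w hw using hin w hw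
    · have hzo := hcover z hz
      have h1 := (hγ.hasDerivAt_contourIntegral_div_pow hfc 0 hzo.1).differentiableAt
      simp only [zero_add, pow_one] at h1
      refine h1.congr_of_eventuallyEq ?_
      filter_upwards [hγ.isOpen_outside.mem_nhds hzo] with w hw using hout w hw
  have hlim : Tendsto h (cocompact ℂ) (𝓝 0) := by
    rw [← Metric.cobounded_eq_cocompact]
    refine (hγ.tendsto_contourIntegral_cobounded hfc).congr' ?_
    obtain ⟨R, hR, hRs⟩ := hγ.exists_trace_subset_closedBall
    filter_upwards [tendsto_norm_cobounded_atTop.eventually_gt_atTop R] with z hz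
    exact (hout z (mem_outside_of_norm_lt hR hRs hz)).symm
  have hzero := fun z => hdiff.apply_eq_of_tendsto_cocompact z hlim
  exact ⟨fun z hz => (hin z hz).symm.trans (hzero z), fun z hz => (hout z hz).symm.trans (hzero z)⟩

theorem IsContour.cauchyJ_of_mem_outside (hγ : IsContour γ) (hU : IsOpen U)
    (hsub : inside γ ∪ trace γ ⊆ U) (hf : DifferentiableOn ℂ f U) {z : ℂ} (hz : z ∈ outside γ) :
    cauchyJ γ f z = 0 := by
  rw [cauchyJ, (hγ.contourIntegral_dslope_eq_zero hU hsub hf).2 z hz, mul_zero]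

theorem IsContour.cauchyJ_of_mem_inside (hγ : IsContour γ) (hpos : PositivelyOriented γ)
    (hU : IsOpen U) (hsub : inside γ ∪ trace γ ⊆ U) (hf : DifferentiableOn ℂ f U) {z : ℂ}
    (hz : z ∈ inside γ) : cauchyJ γ f z = f z := by
  have h1 := (hγ.contourIntegral_dslope_eq_zero hU hsub hf).1 z (hsub (Or.inl hz))
  rw [hγ.contourIntegral_dslope (hf.continuousOn.mono (subset_union_right.trans hsub)) hz.1,
    sub_eq_zero] at h1
  have h2 := hpos z hz
  rw [windingNumber] at h2
  rw [cauchyJ, h1, mul_left_comm, h2, mul_one]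

theorem _root_.DifferentiableOn.iteratedDeriv_of_isOpen (hf : DifferentiableOn ℂ f U)
    (hU : IsOpen U) (n : ℕ) : DifferentiableOn ℂ (iteratedDeriv n f) U := by
  rw [iteratedDeriv_eq_iterate]
  exact ((hf.analyticOnNhd hU).iterated_deriv n).differentiableOn

theorem iteratedDeriv_congr_of_isOpen {g h : ℂ → ℂ} {D : Set ℂ} (hD : IsOpen D)
    (hgh : ∀ z ∈ D, g z = h z) (n : ℕ) {z : ℂ} (hz : z ∈ D) :
    iteratedDeriv n g z = iteratedDeriv n h z :=
  Filter.EventuallyEq.iteratedDeriv_eq n (mem_of_superset (hD.mem_nhds hz) hgh)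

theorem IsContour.cauchyJn_of_mem_outside (hγ : IsContour γ) (hU : IsOpen U)
    (hsub : inside γ ∪ trace γ ⊆ U) (hf : DifferentiableOn ℂ f U) (n : ℕ) {z : ℂ}
    (hz : z ∈ outside γ) : cauchyJn γ f n z = 0 := by
  rw [cauchyJn, iteratedDeriv_congr_of_isOpen hγ.isOpen_outside
    (fun w hw => hγ.cauchyJ_of_mem_outside hU hsub hf hw) n hz]
  simp

theorem IsContour.cauchyJn_of_mem_inside (hγ : IsContour γ) (hpos : PositivelyOriented γ)
    (hU : IsOpen U) (hsub : inside γ ∪ trace γ ⊆ U) (hf : DifferentiableOn ℂ f U) (n : ℕ) {z : ℂ}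
    (hz : z ∈ inside γ) : cauchyJn γ f n z = iteratedDeriv n f z :=
  iteratedDeriv_congr_of_isOpen hγ.isOpen_inside
    (fun _ hw => hγ.cauchyJ_of_mem_inside hpos hU hsub hf hw) n hz

/-- No integration by parts is needed: the right side is the derivative of order `n - m` of the
Cauchy integral of `f⁽ᵐ⁾`, and both sides are known in each domain. -/
theorem IsContour.cauchyJn_eq_cauchyJnm (hγ : IsContour γ) (hpos : PositivelyOriented γ)
    (hU : IsOpen U) (hsub : inside γ ∪ trace γ ⊆ U) (hf : DifferentiableOn ℂ f U) {m n : ℕ}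
    (hmn : m ≤ n) {z : ℂ} (hz : z ∉ trace γ) : cauchyJn γ f n z = cauchyJnm γ f n m z := by
  have hfm := hf.iteratedDeriv_of_isOpen hU m
  have h1 : cauchyJnm γ f n m z = cauchyJn γ (iteratedDeriv m f) (n - m) z :=
    (hγ.cauchyJn_eq (hfm.continuousOn.mono (subset_union_right.trans hsub)) (n - m) hz).symm
  rw [h1]
  rcases mem_inside_or_mem_outside hz with h | h
  · rw [hγ.cauchyJn_of_mem_inside hpos hU hsub hf n h,
      hγ.cauchyJn_of_mem_inside hpos hU hsub hfm (n - m) h]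
    simp only [iteratedDeriv_eq_iterate]
    rw [← Function.iterate_add_apply, Nat.sub_add_cancel hmn]
  · rw [hγ.cauchyJn_of_mem_outside hU hsub hf n h, hγ.cauchyJn_of_mem_outside hU hsub hfm _ h]

theorem IsContour.tendsto_cauchyJn_cobounded (hγ : IsContour γ) (hU : IsOpen U)
    (hsub : inside γ ∪ trace γ ⊆ U) (hf : DifferentiableOn ℂ f U) (n : ℕ) :
    Tendsto (cauchyJn γ f n) (Bornology.cobounded ℂ) (𝓝 0) := by
  refine tendsto_const_nhds.congr' ?_
  obtain ⟨R, hR, hRs⟩ := hγ.exists_trace_subset_closedBall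
  filter_upwards [tendsto_norm_cobounded_atTop.eventually_gt_atTop R] with z hz
  exact (hγ.cauchyJn_of_mem_outside hU hsub hf n (mem_outside_of_norm_lt hR hRs hz)).symm

/-! ### Uniform convergence up to the contour -/

theorem IsContour.isCompact_inside_union_trace (hγ : IsContour γ) :
    IsCompact (inside γ ∪ trace γ) := by
  refine Metric.isCompact_of_isClosed_isBounded ?_
    (hγ.isBounded_inside.union hγ.isCompact_trace.isBounded)
  rw [← compl_outside]
  exact hγ.isOpen_outside.isClosed_compl

theorem IsContour.convergesUniformlyUpTo (hγ : IsContour γ) {g : ℂ → ℂ}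
    (hg : ContinuousOn g (inside γ ∪ trace γ)) :
    ConvergesUniformlyUpTo (inside γ) (trace γ) g g := by
  intro ε hε
  obtain ⟨δ, hδ, h⟩ := Metric.uniformContinuousOn_iff.1
    (hγ.isCompact_inside_union_trace.uniformContinuousOn_of_continuous hg) ε hε
  exact ⟨δ, hδ, fun z₀ hz₀ z hz hd => h z (Or.inl hz) z₀ (Or.inr hz₀) hd⟩

theorem ConvergesUniformlyUpTo.congr {D C : Set ℂ} {g g' b : ℂ → ℂ}
    (h : ConvergesUniformlyUpTo D C g b) (hg : ∀ z ∈ D, g' z = g z) :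
    ConvergesUniformlyUpTo D C g' b := by
  intro ε hε
  obtain ⟨δ, hδ, h'⟩ := h ε hε
  exact ⟨δ, hδ, fun z₀ hz₀ z hz hd => hg z hz ▸ h' z₀ hz₀ z hz hd⟩

theorem convergesUniformlyUpTo_const (D C : Set ℂ) (c : ℂ) :
    ConvergesUniformlyUpTo D C (fun _ => c) fun _ => c :=
  fun ε hε => ⟨1, one_pos, fun _ _ _ _ _ => by simpa using hε⟩

/-! ### Truncation by distance against truncation by parameter -/

/-- Since `‖h x‖` is `‖v‖ x` up to a factor `1 ± κ` near `0`, the two truncations differ only on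
`[l, r]`, of length at most `4κε / ‖v‖`. There `‖G‖ ≤ 3M / ε`, so the error is at most `12Mκ / ‖v‖`,
with `κ` arbitrary. -/
theorem tendsto_integral_indicator_sub_integral {h G : ℝ → ℂ} {v : ℂ} {M δ : ℝ} (hδ : 0 < δ)
    (hc : Continuous h) (hne : ∀ x ∈ Ioc 0 δ, h x ≠ 0) (h0 : h 0 = 0)
    (hd : HasDerivWithinAt h v (Ici 0) 0) (hv : v ≠ 0)
    (hG : MeasureTheory.AEStronglyMeasurable G) (hM0 : 0 < M)
    (hM : ∀ᵐ x, ‖G x‖ ≤ M / ‖h x‖) :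
    Tendsto (fun ε : ℝ => (∫ x in (0 : ℝ)..δ, {x | ε < ‖h x‖}.indicator G x) -
      ∫ x in (ε / ‖v‖)..δ, G x) (𝓝[>] 0) (𝓝 0) := by
  set ρ := ‖v‖ with hρ_def
  have hρ : 0 < ρ := norm_pos_iff.2 hv
  rw [Metric.tendsto_nhds]
  intro η hη
  obtain ⟨κ, hκ0, hκ2, hκη⟩ : ∃ κ : ℝ, 0 < κ ∧ κ ≤ 1 / 2 ∧ 12 * M * κ / ρ < η := by
    refine ⟨min (1 / 2) (η * ρ / (24 * M)), by positivity, min_le_left _ _, ?_⟩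
    rw [div_lt_iff₀ hρ]
    have h1 : min (1 / 2) (η * ρ / (24 * M)) ≤ η * ρ / (24 * M) := min_le_right _ _
    rw [le_div_iff₀ (by positivity)] at h1
    nlinarith [mul_pos hη hρ]
  obtain ⟨δ₁, hδ₁, hδ₁δ, hcone⟩ : ∃ δ₁ > 0, δ₁ ≤ δ ∧ ∀ x ∈ Ioo 0 δ₁,
      (1 - κ) * ρ * x ≤ ‖h x‖ ∧ ‖h x‖ ≤ (1 + κ) * ρ * x := by
    have h1 := (hasDerivWithinAt_iff_isLittleO.1 hd).def (mul_pos hκ0 hρ)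
    rw [h0] at h1
    obtain ⟨d, hd0, hd1⟩ := mem_nhdsGE_iff_exists_Ico_subset.1 h1
    refine ⟨min d δ, lt_min hd0 hδ, min_le_right _ _, fun x hx => ?_⟩
    have h2 : ‖h x - 0 - (x - 0) • v‖ ≤ κ * ρ * ‖x - 0‖ :=
      hd1 ⟨hx.1.le, hx.2.trans_le (min_le_left _ _)⟩
    rw [sub_zero, sub_zero, Real.norm_of_nonneg hx.1.le] at h2
    have h3 : ‖x • v‖ = x * ρ := by rw [norm_smul, Real.norm_of_nonneg hx.1.le]
    have h4 := norm_sub_norm_le (h x) (x • v)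
    have h5 := norm_sub_norm_le (x • v) (h x)
    rw [norm_sub_rev] at h5
    constructor <;> nlinarith
  -- Away from `0` the curve keeps a distance `m`, so for `ε < m` both truncations retain all of
  -- `[δ₁, δ]`.
  obtain ⟨m, hm0, hm⟩ : ∃ m > 0, ∀ x ∈ Icc δ₁ δ, m ≤ ‖h x‖ := by
    obtain ⟨x₀, hx₀, hmin⟩ := isCompact_Icc.exists_isMinOn (nonempty_Icc.2 hδ₁δ)
      hc.norm.continuousOn
    exact ⟨‖h x₀‖, norm_pos_iff.2 (hne _ ⟨hδ₁.trans_le hx₀.1, hx₀.2⟩), fun x hx => hmin hx⟩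
  have hev : ∀ᶠ ε in 𝓝[>] (0 : ℝ), ε < min m (ρ * δ₁) :=
    nhdsWithin_le_nhds (Iio_mem_nhds (by positivity))
  filter_upwards [hev, self_mem_nhdsWithin] with ε hε hε0
  rw [mem_Ioi] at hε0
  have hεm : ε < m := hε.trans_le (min_le_left _ _)
  have hερ : ε / ρ < δ₁ := by
    rw [div_lt_iff₀ hρ, mul_comm]; exact hε.trans_le (min_le_right _ _)
  have hερ0 : 0 < ε / ρ := by positivity
  have hκ1 : 0 < 1 - κ := by linarith
  have hκ1' : 0 < 1 + κ := by linarith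
  set l := ε / (ρ * (1 + κ)) with hl
  set r := ε / (ρ * (1 - κ)) with hr
  have hlr : l ≤ r := by
    rw [hl, hr]; gcongr; linarith
  have hlarge : ∀ x ∈ Ioc 0 δ, ε / ρ < x → ε / 2 ≤ ‖h x‖ := fun x hx hxe => by
    rcases lt_or_ge x δ₁ with h1 | h1
    · rw [div_lt_iff₀ hρ] at hxe
      nlinarith [(hcone x ⟨hx.1, h1⟩).1]
    · linarith [hm x ⟨h1, hx.2⟩]
  have hintA : IntervalIntegrable ({x | ε < ‖h x‖}.indicator G) MeasureTheory.volume 0 δ := by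
    refine (intervalIntegrable_const (c := M / ε)).mono_fun
      (hG.indicator (isOpen_lt continuous_const hc.norm).measurableSet).restrict
      (MeasureTheory.ae_restrict_of_ae (hM.mono fun x hx => ?_))
    rw [Real.norm_of_nonneg (by positivity)]
    dsimp only
    by_cases hxA : ε < ‖h x‖
    · rw [indicator_of_mem (show x ∈ {x | ε < ‖h x‖} from hxA)]
      exact hx.trans (by gcongr)
    · rw [indicator_of_notMem (show x ∉ {x | ε < ‖h x‖} from hxA), norm_zero]
      positivity
  have hintB : IntervalIntegrable ((Ioi (ε / ρ)).indicator G) MeasureTheory.volume 0 δ := by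
    refine (intervalIntegrable_const (c := M / (ε / 2))).mono_fun
      (hG.indicator measurableSet_Ioi).restrict
      ((MeasureTheory.ae_restrict_iff' measurableSet_uIoc).2 (hM.mono fun x hx hxm => ?_))
    rw [uIoc_of_le hδ.le] at hxm
    rw [Real.norm_of_nonneg (by positivity)]
    dsimp only
    by_cases hxA : ε / ρ < x
    · rw [indicator_of_mem (mem_Ioi.2 hxA)]
      have := hlarge x hxm hxA
      exact hx.trans (by gcongr)
    · rw [indicator_of_notMem (show x ∉ Ioi (ε / ρ) from hxA), norm_zero]
      positivity
  have hB : ∫ x in (ε / ρ)..δ, G x = ∫ x in (0 : ℝ)..δ, (Ioi (ε / ρ)).indicator G x := by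
    rw [intervalIntegral.integral_of_le hδ.le, intervalIntegral.integral_of_le (by linarith),
      MeasureTheory.setIntegral_indicator measurableSet_Ioi, Ioc_inter_Ioi, max_eq_right hερ0.le]
  rw [hB, ← intervalIntegral.integral_sub hintA hintB, dist_zero_right]
  have hbound : ∀ᵐ x, x ∈ Ioc 0 δ →
      ‖{x | ε < ‖h x‖}.indicator G x - (Ioi (ε / ρ)).indicator G x‖ ≤
        (Icc l r).indicator (fun _ => 3 * M / ε) x := by
    filter_upwards [hM] with x hx hxm
    have hnn : 0 ≤ (Icc l r).indicator (fun _ => 3 * M / ε) x :=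
      indicator_nonneg (fun _ _ => by positivity) x
    have hGx : x < δ₁ → l ≤ x → x ≤ r →
        ‖G x‖ ≤ (Icc l r).indicator (fun _ => 3 * M / ε) x := fun h1 h2 h3 => by
      rw [indicator_of_mem (show x ∈ Icc l r from ⟨h2, h3⟩)]
      have h4 := (hcone x ⟨hxm.1, h1⟩).1
      have h5 : ε / 3 ≤ ‖h x‖ := by
        refine le_trans ?_ h4
        rw [hl, div_le_iff₀ (by positivity)] at h2
        have : 0 ≤ x * ρ := mul_nonneg hxm.1.le hρ.le
        nlinarith
      refine hx.trans ?_
      have h6 : 3 * M / ε = M / (ε / 3) := by field_simp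
      rw [h6]
      gcongr
    by_cases hxA : ε < ‖h x‖ <;> by_cases hxB : ε / ρ < x
    · rw [indicator_of_mem (show x ∈ {x | ε < ‖h x‖} from hxA), indicator_of_mem (mem_Ioi.2 hxB),
        sub_self, norm_zero]
      exact hnn
    · rw [indicator_of_mem (show x ∈ {x | ε < ‖h x‖} from hxA),
        indicator_of_notMem (show x ∉ Ioi (ε / ρ) from hxB), sub_zero]
      rw [not_lt] at hxB
      have h1 := hxB.trans_lt hερ
      refine hGx h1 ?_ ?_
      · rw [hl, div_le_iff₀ (by positivity)]
        nlinarith [(hcone x ⟨hxm.1, h1⟩).2]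
      · refine hxB.trans ?_
        rw [hr]
        gcongr
        nlinarith
    · rw [indicator_of_notMem (show x ∉ {x | ε < ‖h x‖} from hxA), indicator_of_mem (mem_Ioi.2 hxB),
        zero_sub, norm_neg]
      rw [not_lt] at hxA
      have h1 : x < δ₁ := by
        by_contra h2
        linarith [hm x ⟨not_lt.1 h2, hxm.2⟩]
      refine hGx h1 ?_ ?_
      · refine le_trans ?_ hxB.le
        rw [hl]
        gcongr
        nlinarith
      · rw [hr, le_div_iff₀ (by positivity)]
        nlinarith [(hcone x ⟨hxm.1, h1⟩).1]
    · rw [indicator_of_notMem (show x ∉ {x | ε < ‖h x‖} from hxA),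
        indicator_of_notMem (show x ∉ Ioi (ε / ρ) from hxB), sub_self, norm_zero]
      exact hnn
  have hint : MeasureTheory.Integrable ((Icc l r).indicator fun _ : ℝ => 3 * M / ε) :=
    (MeasureTheory.integrable_indicator_iff measurableSet_Icc).2
      (MeasureTheory.integrableOn_const (by simp) (by simp))
  refine (intervalIntegral.norm_integral_le_of_norm_le hδ.le hbound hint.intervalIntegrable).trans_lt
    (lt_of_le_of_lt ?_ hκη)
  rw [intervalIntegral.integral_of_le hδ.le]
  refine (MeasureTheory.setIntegral_le_integral hint
    (Eventually.of_forall (indicator_nonneg fun _ _ => by positivity))).trans ?_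
  rw [MeasureTheory.integral_indicator measurableSet_Icc, MeasureTheory.setIntegral_const,
    Real.volume_real_Icc_of_le hlr, smul_eq_mul, hl, hr]
  have h1 : (ε / (ρ * (1 - κ)) - ε / (ρ * (1 + κ))) * (3 * M / ε) =
      3 * M / ρ * (2 * κ / ((1 - κ) * (1 + κ))) := by
    field_simp
    ring
  have h2 : 2 * κ / ((1 - κ) * (1 + κ)) ≤ 4 * κ := by
    rw [div_le_iff₀ (by positivity)]
    nlinarith [mul_pos hκ0 hκ0]
  rw [h1]
  calc 3 * M / ρ * (2 * κ / ((1 - κ) * (1 + κ))) ≤ 3 * M / ρ * (4 * κ) := by gcongr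
    _ = 12 * M * κ / ρ := by ring

theorem tendsto_div_of_hasDerivWithinAt_Ici {h : ℝ → ℂ} {v : ℂ} (h0 : h 0 = 0)
    (hd : HasDerivWithinAt h v (Ici 0) 0) : Tendsto (fun x : ℝ => h x / x) (𝓝[>] 0) (𝓝 v) := by
  have h1 := hasDerivWithinAt_iff_tendsto_slope.1 hd
  have h2 : (Ici (0 : ℝ)) \ {0} = Ioi 0 := by
    ext x; simp [lt_iff_le_and_ne, eq_comm]
  rw [h2] at h1
  refine h1.congr fun x => ?_
  rw [slope_def_module, h0, sub_zero, sub_zero, Complex.real_smul, Complex.ofReal_inv,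
    inv_mul_eq_div]

theorem eventually_re_div_pos {h : ℝ → ℂ} {ρ : ℝ} {u : ℂ} (h0 : h 0 = 0) (hu : u ≠ 0) (hρ : 0 < ρ)
    (hd : HasDerivWithinAt h (ρ * u) (Ici 0) 0) : ∀ᶠ x in 𝓝[>] (0 : ℝ), 0 < (h x / u).re := by
  have h1 := (tendsto_div_of_hasDerivWithinAt_Ici h0 hd).div_const u
  rw [mul_div_cancel_right₀ _ hu] at h1
  have h2 := (Complex.continuous_re.tendsto _).comp h1
  filter_upwards [h2.eventually_const_lt (u := 0) hρ, self_mem_nhdsWithin] with x hx hx0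
  rw [mem_Ioi] at hx0
  have h3 : h x / u = (x : ℂ) * (h x / x / u) := by
    have : (x : ℂ) ≠ 0 := Complex.ofReal_ne_zero.2 hx0.ne'
    field_simp
  rw [h3, Complex.re_ofReal_mul]
  exact mul_pos hx0 hx

/-! ### The jump of the winding number across a regular point -/

theorem log_neg_of_im_pos {w : ℂ} (hw : 0 < w.im) :
    Complex.log (-w) = Complex.log w - Real.pi * Complex.I := by
  rw [Complex.log, Complex.log, norm_neg, Complex.arg_neg_eq_arg_sub_pi_of_im_pos hw]
  push_cast
  ring

theorem log_neg_of_im_neg {w : ℂ} (hw : w.im < 0) :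
    Complex.log (-w) = Complex.log w + Real.pi * Complex.I := by
  rw [Complex.log, Complex.log, norm_neg, Complex.arg_neg_eq_arg_add_pi_of_im_neg hw]
  push_cast
  ring

theorem IsContour.exists_tangent (hγ : IsContour γ) {s : ℝ} (hs : HasTangentAt γ s) :
    ∃ (u : ℂ) (ρ₁ ρ₂ : ℝ), ‖u‖ = 1 ∧ 0 < ρ₁ ∧ 0 < ρ₂ ∧
      HasDerivWithinAt γ (ρ₁ * u) (Ici s) s ∧ HasDerivWithinAt γ (ρ₂ * u) (Iic s) s := by
  obtain ⟨r, hr, h⟩ := hs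
  obtain ⟨v, hv, hdv⟩ := hγ.exists_hasDerivWithinAt_Ici s
  obtain ⟨w, hw, hdw⟩ := hγ.exists_hasDerivWithinAt_Iic s
  rw [hdv.derivWithin (uniqueDiffOn_Ici s s self_mem_Ici),
    hdw.derivWithin (uniqueDiffOn_Iic s s self_mem_Iic)] at h
  have hw0 : 0 < ‖w‖ := norm_pos_iff.2 hw
  have hw0' : (‖w‖ : ℂ) ≠ 0 := Complex.ofReal_ne_zero.2 hw0.ne'
  refine ⟨w / ‖w‖, r * ‖w‖, ‖w‖, ?_, by positivity, hw0, ?_, ?_⟩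
  · rw [norm_div, Complex.norm_real, norm_norm, div_self hw0.ne']
  · convert hdv using 1
    rw [h]
    push_cast
    field_simp
  · convert hdw using 1
    field_simp

theorem hasDerivWithinAt_right_germ {v : ℂ} {s : ℝ} (h : HasDerivWithinAt γ v (Ici s) s) :
    HasDerivWithinAt (fun x => γ (s + x) - γ s) v (Ici 0) 0 := by
  have h1 : HasDerivWithinAt (fun x : ℝ => s + x) 1 (Ici 0) 0 :=
    ((hasDerivAt_id (0 : ℝ)).const_add s).hasDerivWithinAt
  have h2 := HasDerivWithinAt.scomp (t' := Ici s) (0 : ℝ) (by simpa using h) h1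
    (fun x hx => by simpa using hx)
  rw [one_smul] at h2
  exact h2.sub_const _

theorem hasDerivWithinAt_left_germ {v : ℂ} {s : ℝ} (h : HasDerivWithinAt γ v (Iic s) s) :
    HasDerivWithinAt (fun x => γ (s - x) - γ s) (-v) (Ici 0) 0 := by
  have h1 : HasDerivWithinAt (fun x : ℝ => s - x) (-1) (Ici 0) 0 :=
    ((hasDerivAt_id (0 : ℝ)).const_sub s).hasDerivWithinAt
  have h2 := HasDerivWithinAt.scomp (t' := Iic s) (0 : ℝ) (by simpa using h) h1
    (fun x hx => by simpa using hx)
  rw [neg_one_smul] at h2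
  exact h2.sub_const _

theorem IsContour.arc_ne (hγ : IsContour γ) {s₀ a b s : ℝ} (ha : 0 < a) (hb : 0 < b)
    (hs : s ∈ Icc (s₀ + b) (s₀ - a + 1)) : γ s ≠ γ s₀ := fun h => by
  obtain ⟨n, hn⟩ := hγ.eq_add_int h
  have h1 : (0 : ℝ) < n := by linarith [hs.1]
  have h2 : (n : ℝ) < 1 := by linarith [hs.2]
  have h3 : (0 : ℤ) < n := by exact_mod_cast h1
  have h4 : n < (1 : ℤ) := by exact_mod_cast h2
  omega

theorem IsContour.continuousAt_arc_integral (hγ : IsContour γ) {a b : ℝ} (hab : a ≤ b) {z₀ : ℂ}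
    (hz₀ : ∀ s ∈ Icc a b, γ s ≠ z₀) :
    ContinuousAt (fun w => ∫ s in a..b, 1 / (γ s - w) * deriv γ s) z₀ := by
  obtain ⟨M, hM0, hM⟩ := hγ.exists_ae_norm_deriv_le
  obtain ⟨r, hr, hball⟩ := Metric.isOpen_iff.1
    (isCompact_Icc.image hγ.continuous).isClosed.isOpen_compl z₀
    (fun ⟨s, hs, h⟩ => hz₀ s hs h : z₀ ∈ (γ '' Icc a b)ᶜ)
  have hdist : ∀ s ∈ Icc a b, ∀ w ∈ Metric.ball z₀ (r / 2), r / 2 ≤ ‖γ s - w‖ := by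
    intro s hs w hw
    have h1 : r ≤ dist (γ s) z₀ := not_lt.1 fun h =>
      hball (Metric.mem_ball.2 h) (mem_image_of_mem γ hs)
    rw [Metric.mem_ball] at hw
    rw [← dist_eq_norm]
    linarith [dist_triangle (γ s) w z₀]
  have hne : ∀ s ∈ Icc a b, ∀ w ∈ Metric.ball z₀ (r / 2), γ s - w ≠ 0 := fun s hs w hw =>
    norm_pos_iff.1 ((half_pos hr).trans_le (hdist s hs w hw))
  refine (hasDerivAt_intervalIntegral_of_norm_le (a := a) (b := b)
    (F := fun w s => 1 / (γ s - w) * deriv γ s) (r := r / 2) (B := 1 / (r / 2) * M)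
    (half_pos hr) ?_ ?_ ?_).continuousAt
  · intro w hw
    refine (hγ.intervalIntegrable_mul_deriv ?_).aestronglyMeasurable_restrict_uIoc
    rw [uIcc_of_le hab]
    exact continuousOn_const.div (hγ.continuous.sub continuous_const).continuousOn
      fun s hs => hne s hs w hw
  · refine Eventually.of_forall fun s hs => ?_
    rw [uIoc_of_le hab] at hs
    exact ((differentiableOn_const _).div ((differentiableOn_const _).sub differentiableOn_id)
      (hne s (Ioc_subset_Icc_self hs))).mul_const _
  · filter_upwards [hM] with s hs hm w hw
    rw [uIoc_of_le hab] at hm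
    rw [norm_mul, norm_div, norm_one]
    gcongr
    exact hdist s (Ioc_subset_Icc_self hm) w hw

theorem IsContour.periodic_deriv (hγ : IsContour γ) : Function.Periodic (deriv γ) 1 := fun x => by
  rw [← deriv_comp_add_const]
  congr 1
  exact funext hγ.periodic

theorem IsContour.contourIntegral_eq_shift (hγ : IsContour γ) (g : ℂ → ℂ) (a : ℝ) :
    contourIntegral γ g = ∫ s in a..a + 1, g (γ s) * deriv γ s := by
  have h : Function.Periodic (fun s => g (γ s) * deriv γ s) 1 := fun x => by
    simp only [hγ.periodic x, hγ.periodic_deriv x]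
  rw [contourIntegral, h.intervalIntegral_add_eq a 0, zero_add]

/-- For `c = ± i` the imaginary part is `±` the tangential coordinate, which vanishes only at `s₀`.
There the value is `η > 0`, so the germ crosses the real axis on the positive side and the principal
logarithm is holomorphic along it. -/
theorem mem_slitPlane_of_germ {s₀ a b η s : ℝ} {u c : ℂ}
    (hright : ∀ x ∈ Ioc 0 b, 0 < ((γ (s₀ + x) - γ s₀) / u).re)
    (hleft : ∀ x ∈ Ioc 0 a, ((γ (s₀ - x) - γ s₀) / u).re < 0)
    (hc0 : c.re = 0) (hc1 : c.im ≠ 0) (hη : 0 < η) (hs : s ∈ Icc (s₀ - a) (s₀ + b)) :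
    c * ((γ s - γ s₀) / u) + η ∈ Complex.slitPlane := by
  have him : (c * ((γ s - γ s₀) / u) + η).im = c.im * ((γ s - γ s₀) / u).re := by
    simp [Complex.mul_im, hc0]
  rcases lt_trichotomy s s₀ with h | rfl | h
  · refine Complex.mem_slitPlane_iff.2 (Or.inr ?_)
    have := hleft (s₀ - s) ⟨by linarith, by linarith [hs.1]⟩
    rw [sub_sub_cancel] at this
    rw [him]
    exact mul_ne_zero hc1 this.ne
  · refine Complex.mem_slitPlane_iff.2 (Or.inl ?_)
    simpa using hη
  · refine Complex.mem_slitPlane_iff.2 (Or.inr ?_)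
    have := hright (s - s₀) ⟨by linarith, by linarith [hs.2]⟩
    rw [add_sub_cancel] at this
    rw [him]
    exact mul_ne_zero hc1 this.ne'

theorem germ_sub_eq {s s₀ η : ℝ} {u c : ℂ} (hu : u ≠ 0) (hc : c * c = -1) :
    c * ((γ s - γ s₀) / u) + η = c / u * (γ s - (γ s₀ + c * η * u)) := by
  field_simp
  linear_combination ((η : ℂ) * u) * hc

theorem IsContour.integral_germ (hγ : IsContour γ) {s₀ a b η : ℝ} {u c : ℂ} (ha : 0 < a)
    (hb : 0 < b) (hu : u ≠ 0)
    (hright : ∀ x ∈ Ioc 0 b, 0 < ((γ (s₀ + x) - γ s₀) / u).re)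
    (hleft : ∀ x ∈ Ioc 0 a, ((γ (s₀ - x) - γ s₀) / u).re < 0)
    (hc : c * c = -1) (hc0 : c.re = 0) (hc1 : c.im ≠ 0) (hη : 0 < η) :
    ∫ s in (s₀ - a)..(s₀ + b), 1 / (γ s - (γ s₀ + c * η * u)) * deriv γ s =
      Complex.log (c * ((γ (s₀ + b) - γ s₀) / u) + η) -
        Complex.log (c * ((γ (s₀ - a) - γ s₀) / u) + η) := by
  have hslit := fun s hs => mem_slitPlane_of_germ (s := s) hright hleft hc0 hc1 hη hs
  have hc' : c ≠ 0 := fun h => by simp [h] at hc1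
  have hne : ∀ s ∈ Icc (s₀ - a) (s₀ + b), γ s - (γ s₀ + c * η * u) ≠ 0 := fun s hs h => by
    have h1 := hslit s hs
    rw [germ_sub_eq hu hc, h, mul_zero] at h1
    exact Complex.zero_notMem_slitPlane h1
  refine hγ.integral_comp_mul_deriv (F := fun t => Complex.log (c * ((t - γ s₀) / u) + η))
    (F' := fun t => 1 / (t - (γ s₀ + c * η * u))) (by linarith) ?_ ?_
  · intro s hs
    have h1 := (((((hasDerivAt_id (γ s)).sub_const (γ s₀)).div_const u).const_mul c).add_const
      (η : ℂ)).clog (hslit s hs)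
    refine h1.congr_deriv ?_
    have h2 := hne s hs
    simp only [id]
    rw [germ_sub_eq hu hc]
    field_simp
  · exact continuousOn_const.div (hγ.continuous.sub continuous_const).continuousOn hne

theorem IsContour.tendsto_contourIntegral_normal (hγ : IsContour γ) {s₀ a b : ℝ} {u c : ℂ}
    (ha : 0 < a) (hb : 0 < b) (hab : a + b ≤ 1) (hu : u ≠ 0)
    (hright : ∀ x ∈ Ioc 0 b, 0 < ((γ (s₀ + x) - γ s₀) / u).re)
    (hleft : ∀ x ∈ Ioc 0 a, ((γ (s₀ - x) - γ s₀) / u).re < 0)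
    (hc : c * c = -1) (hc0 : c.re = 0) (hc1 : c.im ≠ 0) :
    (∀ᶠ η : ℝ in 𝓝[>] 0, γ s₀ + c * η * u ∉ trace γ) ∧
    Tendsto (fun η : ℝ => contourIntegral γ fun t => 1 / (t - (γ s₀ + c * η * u))) (𝓝[>] 0)
      (𝓝 ((∫ s in (s₀ + b)..(s₀ - a + 1), 1 / (γ s - γ s₀) * deriv γ s) +
        (Complex.log (c * ((γ (s₀ + b) - γ s₀) / u)) -
          Complex.log (c * ((γ (s₀ - a) - γ s₀) / u))))) := by
  have hz : Tendsto (fun η : ℝ => γ s₀ + c * η * u) (𝓝[>] 0) (𝓝 (γ s₀)) := by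
    have : ContinuousAt (fun η : ℝ => γ s₀ + c * η * u) 0 := by fun_prop
    simpa using this.tendsto.mono_left nhdsWithin_le_nhds
  have harc : ∀ s ∈ Icc (s₀ + b) (s₀ - a + 1), γ s ≠ γ s₀ := fun s hs => hγ.arc_ne ha hb hs
  have hle : s₀ + b ≤ s₀ - a + 1 := by linarith
  have hoff : ∀ᶠ η : ℝ in 𝓝[>] 0, γ s₀ + c * η * u ∉ trace γ := by
    have h1 : (γ '' Icc (s₀ + b) (s₀ - a + 1))ᶜ ∈ 𝓝 (γ s₀) :=
      (isCompact_Icc.image hγ.continuous).isClosed.isOpen_compl.mem_nhds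
        fun ⟨s, hs, h⟩ => harc s hs h
    -- A contour point on the normal would lie on the germ, where the slit-plane value would be `0`,
    -- or on the far arc, which has positive distance from `γ s₀`.
    filter_upwards [hz.eventually h1, self_mem_nhdsWithin] with η hη hη0 hmem
    obtain ⟨t, -, ht⟩ := hmem
    obtain ⟨s, hs, hst⟩ := hγ.periodic.exists_mem_Ico one_pos t (s₀ - a)
    rw [hst] at ht
    rcases le_or_gt s (s₀ + b) with h | h
    · have h2 := mem_slitPlane_of_germ hright hleft hc0 hc1 hη0 ⟨hs.1, h⟩
      rw [germ_sub_eq hu hc, ht, sub_self, mul_zero] at h2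
      exact Complex.zero_notMem_slitPlane h2
    · exact hη ⟨s, ⟨h.le, hs.2.le⟩, ht⟩
  refine ⟨hoff, ?_⟩
  have h1 := (hγ.continuousAt_arc_integral hle harc).tendsto.comp hz
  have hlog : ∀ q : ℂ, q.re ≠ 0 → Tendsto (fun η : ℝ => Complex.log (c * q + η)) (𝓝[>] 0)
      (𝓝 (Complex.log (c * q))) := fun q hq => by
    have h2 : c * q + ((0 : ℝ) : ℂ) ∈ Complex.slitPlane := by
      refine Complex.mem_slitPlane_iff.2 (Or.inr ?_)
      simpa [Complex.mul_im, hc0] using ⟨hc1, hq⟩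
    have h3 : ContinuousAt (fun η : ℝ => Complex.log (c * q + η)) 0 :=
      ContinuousAt.clog (by fun_prop) h2
    simpa using h3.tendsto.mono_left nhdsWithin_le_nhds
  have h2 := h1.add ((hlog _ (hright b ⟨hb, le_rfl⟩).ne').sub (hlog _ (hleft a ⟨ha, le_rfl⟩).ne))
  refine h2.congr' ?_
  filter_upwards [hoff, self_mem_nhdsWithin] with η hη hη0
  have hint : ∀ p q, IntervalIntegrable
      (fun s => 1 / (γ s - (γ s₀ + c * η * u)) * deriv γ s) MeasureTheory.volume p q := fun p q =>
    hγ.intervalIntegrable_mul_deriv (continuousOn_const.div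
      (hγ.continuous.sub continuous_const).continuousOn
      fun s _ h => hη (sub_eq_zero.1 h ▸ hγ.mem_trace s))
  rw [hγ.contourIntegral_eq_shift _ (s₀ - a),
    ← intervalIntegral.integral_add_adjacent_intervals (hint _ (s₀ + b)) (hint _ _),
    hγ.integral_germ ha hb hu hright hleft hc hc0 hc1 hη0, add_comm]
  rfl

theorem IsContour.windingNumber_eq_zero_or_one (hγ : IsContour γ) (hpos : PositivelyOriented γ)
    {z : ℂ} (hz : z ∉ trace γ) : windingNumber γ z = 0 ∨ windingNumber γ z = 1 := by
  rcases mem_inside_or_mem_outside hz with h | h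
  · exact Or.inr (hpos z h)
  · exact Or.inl (hγ.windingNumber_eq_zero h)

/-- Replacing `i` by `-i` lowers the logarithm at the right end by `πi` and raises the one at the
left end by `πi`, so the two limits of the winding number differ by `1`. This also shows that
`inside γ` is nonempty. -/
theorem IsContour.jump (hγ : IsContour γ) (hpos : PositivelyOriented γ) {s₀ a b : ℝ} {u : ℂ}
    (ha : 0 < a) (hb : 0 < b) (hab : a + b ≤ 1) (hu : u ≠ 0)
    (hright : ∀ x ∈ Ioc 0 b, 0 < ((γ (s₀ + x) - γ s₀) / u).re)
    (hleft : ∀ x ∈ Ioc 0 a, ((γ (s₀ - x) - γ s₀) / u).re < 0) :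
    (∫ s in (s₀ + b)..(s₀ - a + 1), 1 / (γ s - γ s₀) * deriv γ s) +
        (Complex.log (Complex.I * ((γ (s₀ + b) - γ s₀) / u)) -
          Complex.log (Complex.I * ((γ (s₀ - a) - γ s₀) / u))) = 2 * Real.pi * Complex.I ∧
      γ s₀ ∈ closure (inside γ) ∧ γ s₀ ∈ closure (outside γ) := by
  obtain ⟨hoffL, hlimL⟩ := hγ.tendsto_contourIntegral_normal ha hb hab hu hright hleft
    (c := Complex.I) Complex.I_mul_I (by simp) (by simp)
  obtain ⟨hoffR, hlimR⟩ := hγ.tendsto_contourIntegral_normal ha hb hab hu hright hleft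
    (c := -Complex.I) (by simp) (by simp) (by simp)
  have hQ : Complex.log (-Complex.I * ((γ (s₀ + b) - γ s₀) / u)) =
      Complex.log (Complex.I * ((γ (s₀ + b) - γ s₀) / u)) - Real.pi * Complex.I := by
    rw [neg_mul, log_neg_of_im_pos]
    rw [Complex.I_mul_im]
    exact hright b ⟨hb, le_rfl⟩
  have hP : Complex.log (-Complex.I * ((γ (s₀ - a) - γ s₀) / u)) =
      Complex.log (Complex.I * ((γ (s₀ - a) - γ s₀) / u)) + Real.pi * Complex.I := by
    rw [neg_mul, log_neg_of_im_neg]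
    rw [Complex.I_mul_im]
    exact hleft a ⟨ha, le_rfl⟩
  rw [hQ, hP] at hlimR
  set L := (∫ s in (s₀ + b)..(s₀ - a + 1), 1 / (γ s - γ s₀) * deriv γ s) +
    (Complex.log (Complex.I * ((γ (s₀ + b) - γ s₀) / u)) -
      Complex.log (Complex.I * ((γ (s₀ - a) - γ s₀) / u))) with hL
  have hpi := Complex.two_pi_I_ne_zero
  have hclosed : IsClosed ({0, 1} : Set ℂ) := (toFinite _).isClosed
  have hwL : Tendsto (fun η : ℝ => windingNumber γ (γ s₀ + Complex.I * η * u)) (𝓝[>] 0)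
      (𝓝 (1 / (2 * Real.pi * Complex.I) * L)) := hlimL.const_mul _
  have hwR : Tendsto (fun η : ℝ => windingNumber γ (γ s₀ + -Complex.I * η * u)) (𝓝[>] 0)
      (𝓝 (1 / (2 * Real.pi * Complex.I) * L - 1)) := by
    refine (hlimR.const_mul (1 / (2 * Real.pi * Complex.I))).trans (le_of_eq ?_)
    congr 1
    rw [hL]
    field_simp
    ring
  have hmemL : 1 / (2 * Real.pi * Complex.I) * L ∈ ({0, 1} : Set ℂ) :=
    hclosed.mem_of_tendsto hwL (hoffL.mono fun η h => hγ.windingNumber_eq_zero_or_one hpos h)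
  have hmemR : 1 / (2 * Real.pi * Complex.I) * L - 1 ∈ ({0, 1} : Set ℂ) :=
    hclosed.mem_of_tendsto hwR (hoffR.mono fun η h => hγ.windingNumber_eq_zero_or_one hpos h)
  -- The value `0` on the left would force `-1` on the right.
  have hL1 : 1 / (2 * Real.pi * Complex.I) * L = 1 := by
    rcases hmemL with h | h
    · rw [h] at hmemR
      rcases hmemR with h' | h' <;> norm_num at h'
    · exact h
  rw [hL1] at hwL hwR
  rw [sub_self] at hwR
  have hz : ∀ c : ℂ, Tendsto (fun η : ℝ => γ s₀ + c * η * u) (𝓝[>] 0) (𝓝 (γ s₀)) := fun c => by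
    have : ContinuousAt (fun η : ℝ => γ s₀ + c * η * u) 0 := by fun_prop
    simpa using this.tendsto.mono_left nhdsWithin_le_nhds
  refine ⟨?_, mem_closure_of_tendsto (hz Complex.I) ?_, mem_closure_of_tendsto (hz (-Complex.I)) ?_⟩
  · rwa [one_div, inv_mul_eq_one₀ hpi, eq_comm] at hL1
  · filter_upwards [hoffL, hwL.eventually_ne one_ne_zero] with η h1 h2
    exact (mem_inside_or_mem_outside h1).resolve_right fun h => h2 (hγ.windingNumber_eq_zero h)
  · filter_upwards [hoffR, hwR.eventually_ne zero_ne_one] with η h1 h2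
    exact (mem_inside_or_mem_outside h1).resolve_left fun h => h2 (hpos _ h)

theorem exists_germ_bounds {s₀ ρ₁ ρ₂ : ℝ} {u : ℂ} (hu : u ≠ 0)
    (h₁ : 0 < ρ₁) (h₂ : 0 < ρ₂) (hd₁ : HasDerivWithinAt γ (ρ₁ * u) (Ici s₀) s₀)
    (hd₂ : HasDerivWithinAt γ (ρ₂ * u) (Iic s₀) s₀) :
    ∃ δ > 0, δ ≤ 1 / 2 ∧ (∀ x ∈ Ioc 0 δ, 0 < ((γ (s₀ + x) - γ s₀) / u).re) ∧
      ∀ x ∈ Ioc 0 δ, ((γ (s₀ - x) - γ s₀) / u).re < 0 := by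
  have e₁ := eventually_re_div_pos (h := fun x => γ (s₀ + x) - γ s₀) (by simp) hu h₁
    (hasDerivWithinAt_right_germ hd₁)
  have e₂ := eventually_re_div_pos (h := fun x => γ (s₀ - x) - γ s₀) (u := -u)
    (by simp) (neg_ne_zero.2 hu) h₂
    (by simpa using hasDerivWithinAt_left_germ hd₂)
  obtain ⟨δ, hδ, h⟩ := mem_nhdsGT_iff_exists_Ioc_subset.1 (e₁.and e₂)
  refine ⟨min δ (1 / 2), lt_min hδ (by norm_num), min_le_right _ _, fun x hx => ?_, fun x hx => ?_⟩
  · exact (h ⟨hx.1, hx.2.trans (min_le_left _ _)⟩).1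
  · have := (h ⟨hx.1, hx.2.trans (min_le_left _ _)⟩).2
    rwa [div_neg, Complex.neg_re, neg_pos] at this

/-! ### Closures of the two domains -/

theorem IsContour.mem_closure_of_hasTangentAt (hγ : IsContour γ) (hpos : PositivelyOriented γ)
    {s : ℝ} (hs : HasTangentAt γ s) : γ s ∈ closure (inside γ) ∧ γ s ∈ closure (outside γ) := by
  obtain ⟨u, ρ₁, ρ₂, hu1, h₁, h₂, hd₁, hd₂⟩ := hγ.exists_tangent hs
  have hu : u ≠ 0 := norm_pos_iff.1 (hu1 ▸ one_pos)
  obtain ⟨δ, hδ, hδ2, hr, hl⟩ := exists_germ_bounds hu h₁ h₂ hd₁ hd₂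
  exact (hγ.jump hpos hδ hδ (by linarith) hu hr hl).2

/-- Regular parameters are dense, having a countable complement, so corners and cusps are reached by
continuity. -/
theorem IsContour.trace_subset_of_isClosed (hγ : IsContour γ) {K : Set ℂ} (hK : IsClosed K)
    (h : ∀ s, HasTangentAt γ s → γ s ∈ K) : trace γ ⊆ K := by
  obtain ⟨S, M, hS, hd⟩ := hγ.exists_countable_hasDerivAt
  have h1 : closure Sᶜ ⊆ γ ⁻¹' K := closure_minimal (fun s hs => by
    obtain ⟨v, -, -, hv⟩ := hd s hs
    exact h s (hasTangentAt_of_hasDerivAt hv)) (hK.preimage hγ.continuous)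
  rw [(hS.dense_compl ℝ).closure_eq] at h1
  rintro _ ⟨s, -, rfl⟩
  exact h1 (mem_univ s)

theorem IsContour.closure_inside (hγ : IsContour γ) (hpos : PositivelyOriented γ) :
    closure (inside γ) = inside γ ∪ trace γ := by
  refine subset_antisymm (closure_minimal subset_union_left hγ.isCompact_inside_union_trace.isClosed)
    (union_subset subset_closure ?_)
  exact hγ.trace_subset_of_isClosed isClosed_closure
    fun s hs => (hγ.mem_closure_of_hasTangentAt hpos hs).1

theorem IsContour.closure_outside (hγ : IsContour γ) (hpos : PositivelyOriented γ) :
    closure (outside γ) = outside γ ∪ trace γ := by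
  refine subset_antisymm (closure_minimal subset_union_left ?_) (union_subset subset_closure ?_)
  · rw [← compl_inside]
    exact hγ.isOpen_inside.isClosed_compl
  · exact hγ.trace_subset_of_isClosed isClosed_closure
      fun s hs => (hγ.mem_closure_of_hasTangentAt hpos hs).2

/-! ### Principal values -/

theorem IsContour.aestronglyMeasurable_mul_deriv (hγ : IsContour γ) {g : ℂ → ℂ}
    (hg : ContinuousOn g (trace γ)) (z : ℂ) :
    MeasureTheory.AEStronglyMeasurable (fun s => g (γ s) / (γ s - z) * deriv γ s) :=
  ((((hg.comp_continuous hγ.continuous hγ.mem_trace).measurable.div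
    (hγ.continuous.measurable.sub_const z)).mul (measurable_deriv γ))).aestronglyMeasurable

theorem IsContour.intervalIntegrable_indicator (hγ : IsContour γ) {g : ℂ → ℂ}
    (hg : ContinuousOn g (trace γ)) (z : ℂ) {ε : ℝ} (hε : 0 < ε) (a b : ℝ) :
    IntervalIntegrable ({s | ε < ‖γ s - z‖}.indicator fun s => g (γ s) / (γ s - z) * deriv γ s)
      MeasureTheory.volume a b := by
  obtain ⟨M, hM0, hM⟩ := hγ.exists_ae_norm_deriv_le
  obtain ⟨G, hG⟩ := hγ.isCompact_trace.exists_bound_of_continuousOn hg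
  have hG0 : 0 ≤ G := (norm_nonneg _).trans (hG _ (hγ.mem_trace 0))
  have hmeas : MeasurableSet {s | ε < ‖γ s - z‖} :=
    (isOpen_lt continuous_const (hγ.continuous.sub continuous_const).norm).measurableSet
  refine (intervalIntegrable_const (c := G / ε * M)).mono_fun
    ((hγ.aestronglyMeasurable_mul_deriv hg z).indicator hmeas).restrict
    (MeasureTheory.ae_restrict_of_ae (hM.mono fun s hs => ?_))
  rw [Real.norm_of_nonneg (by positivity)]
  dsimp only
  by_cases h : ε < ‖γ s - z‖
  · rw [indicator_of_mem (show s ∈ {s | ε < ‖γ s - z‖} from h), norm_mul, norm_div]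
    gcongr
    exact hG _ (hγ.mem_trace s)
  · rw [indicator_of_notMem (show s ∉ {s | ε < ‖γ s - z‖} from h), norm_zero]
    positivity

/-- The arc is cut at the opposite parameter `s₀ + 1/2`, and its second half is moved back by one
period and reversed, so that both halves start near `s₀`. -/
theorem IsContour.integral_arc_split (hγ : IsContour γ) {s₀ a b : ℝ} (ha : 0 < a) (hb : 0 < b)
    (ha2 : a ≤ 1 / 2) (hb2 : b ≤ 1 / 2) :
    ∫ s in (s₀ + b)..(s₀ - a + 1), 1 / (γ s - γ s₀) * deriv γ s =
      (∫ x in b..1 / 2, 1 / (γ (s₀ + x) - γ s₀) * deriv γ (s₀ + x)) +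
        ∫ x in a..1 / 2, 1 / (γ (s₀ - x) - γ s₀) * deriv γ (s₀ - x) := by
  set F : ℝ → ℂ := fun s => 1 / (γ s - γ s₀) * deriv γ s with hF
  have hper : Function.Periodic F 1 := fun x => by
    simp only [hF, hγ.periodic x, hγ.periodic_deriv x]
  have hint : ∀ p q, s₀ + b ≤ p → p ≤ q → q ≤ s₀ - a + 1 →
      IntervalIntegrable F MeasureTheory.volume p q := fun p q hp hpq hq => by
    refine hγ.intervalIntegrable_mul_deriv (continuousOn_const.div
      (hγ.continuous.sub continuous_const).continuousOn fun s hs => ?_)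
    rw [uIcc_of_le hpq] at hs
    exact sub_ne_zero.2 (hγ.arc_ne ha hb ⟨hp.trans hs.1, hs.2.trans hq⟩)
  rw [← intervalIntegral.integral_add_adjacent_intervals
    (hint _ (s₀ + 1 / 2) le_rfl (by linarith) (by linarith))
    (hint _ _ (by linarith) (by linarith) le_rfl)]
  congr 1
  · rw [← intervalIntegral.integral_comp_add_left F s₀]
  · rw [intervalIntegral.integral_comp_sub_left F s₀]
    have h1 := intervalIntegral.integral_comp_add_right F (a := s₀ - 1 / 2) (b := s₀ - a) 1
    rw [show s₀ - 1 / 2 + 1 = s₀ + 1 / 2 by ring] at h1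
    rw [← h1]
    simp only [hper _]

theorem IsContour.integral_indicator_split (hγ : IsContour γ) (s₀ : ℝ) {ε : ℝ} (hε : 0 < ε) :
    ∫ s in (0 : ℝ)..1, {s : ℝ | ε < ‖γ s - γ s₀‖}.indicator
        (fun s => 1 / (γ s - γ s₀) * deriv γ s) s =
      (∫ x in (0 : ℝ)..1 / 2, {x | ε < ‖γ (s₀ + x) - γ s₀‖}.indicator
        (fun x => 1 / (γ (s₀ + x) - γ s₀) * deriv γ (s₀ + x)) x) +
      ∫ x in (0 : ℝ)..1 / 2, {x | ε < ‖γ (s₀ - x) - γ s₀‖}.indicator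
        (fun x => 1 / (γ (s₀ - x) - γ s₀) * deriv γ (s₀ - x)) x := by
  set F : ℝ → ℂ := {s : ℝ | ε < ‖γ s - γ s₀‖}.indicator
    (fun s => 1 / (γ s - γ s₀) * deriv γ s) with hF
  have hint : ∀ p q, IntervalIntegrable F MeasureTheory.volume p q := fun p q =>
    hγ.intervalIntegrable_indicator (g := fun _ => 1) continuousOn_const _ hε p q
  have hper : Function.Periodic F 1 := fun x => by
    simp only [hF, indicator, mem_ofPred_eq, hγ.periodic x, hγ.periodic_deriv x]
  have h1 := hper.intervalIntegral_add_eq (s₀ - 1 / 2) 0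
  rw [show s₀ - 1 / 2 + 1 = s₀ + 1 / 2 by ring, zero_add] at h1
  rw [← h1, ← intervalIntegral.integral_add_adjacent_intervals (hint _ s₀) (hint _ _), add_comm]
  have e₁ := intervalIntegral.integral_comp_add_left F (a := 0) (b := 1 / 2) s₀
  have e₂ := intervalIntegral.integral_comp_sub_left F (a := 0) (b := 1 / 2) s₀
  rw [add_zero] at e₁
  rw [sub_zero] at e₂
  rw [← e₁, ← e₂]
  rfl

theorem tendsto_germ_div {h : ℝ → ℂ} {u : ℂ} {ρ : ℝ} (h0 : h 0 = 0) (hu : u ≠ 0) (hρ : 0 < ρ)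
    (hd : HasDerivWithinAt h (ρ * u) (Ici 0) 0) :
    Tendsto (fun ε : ℝ => h (ε / ρ) / u / ε) (𝓝[>] 0) (𝓝 1) := by
  have h1 : Tendsto (fun ε : ℝ => ε / ρ) (𝓝[>] 0) (𝓝[>] 0) := by
    refine tendsto_nhdsWithin_iff.2 ⟨?_, ?_⟩
    · have : ContinuousAt (fun ε : ℝ => ε / ρ) 0 := by fun_prop
      simpa using this.tendsto.mono_left nhdsWithin_le_nhds
    · filter_upwards [self_mem_nhdsWithin] with ε hε using div_pos hε hρ
  have hρ' : (ρ : ℂ) ≠ 0 := Complex.ofReal_ne_zero.2 hρ.ne'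
  have h2 := ((tendsto_div_of_hasDerivWithinAt_Ici h0 hd).comp h1).div_const (ρ * u)
  rw [div_self (mul_ne_zero hρ' hu)] at h2
  refine h2.congr' ?_
  filter_upwards [self_mem_nhdsWithin] with ε hε
  have hε' : (ε : ℂ) ≠ 0 := Complex.ofReal_ne_zero.2 (ne_of_gt hε)
  simp only [Function.comp]
  push_cast
  field_simp

theorem IsContour.hasPrincipalValue_one (hγ : IsContour γ) (hpos : PositivelyOriented γ) {s₀ : ℝ}
    (hs : HasTangentAt γ s₀) :
    HasPrincipalValue γ (fun _ => 1) (γ s₀) (Real.pi * Complex.I) := by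
  obtain ⟨u, ρ₁, ρ₂, hu1, h₁, h₂, hd₁, hd₂⟩ := hγ.exists_tangent hs
  have hu : u ≠ 0 := norm_pos_iff.1 (hu1 ▸ one_pos)
  obtain ⟨M, hM0, hM⟩ := hγ.exists_ae_norm_deriv_le
  obtain ⟨δ, hδ, hδ2, hr, hl⟩ := exists_germ_bounds hu h₁ h₂ hd₁ hd₂
  have hne : ∀ x : ℝ, x ≠ 0 → |x| ≤ 1 / 2 → γ (s₀ + x) - γ s₀ ≠ 0 := fun x hx hx2 h => by
    obtain ⟨n, hn⟩ := hγ.eq_add_int (sub_eq_zero.1 h)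
    have hxn : x = n := by linarith
    rw [hxn] at hx2 hx
    have h1 : |n| < 1 := by
      have : |(n : ℝ)| < 1 := by linarith
      exact_mod_cast this
    rw [Int.abs_lt_one_iff] at h1
    exact hx (by exact_mod_cast h1)
  have hmeas := hγ.aestronglyMeasurable_mul_deriv (g := fun _ => 1) continuousOn_const (γ s₀)
  have hbound : ∀ᵐ s, ‖1 / (γ s - γ s₀) * deriv γ s‖ ≤ M / ‖γ s - γ s₀‖ := by
    filter_upwards [hM] with s hs
    rw [norm_mul, norm_div, norm_one, one_div_mul_eq_div]
    gcongr
  have hgerm₁ := hasDerivWithinAt_right_germ hd₁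
  have hgerm₂ := hasDerivWithinAt_left_germ hd₂
  have hn₁ : ‖(ρ₁ : ℂ) * u‖ = ρ₁ := by
    rw [norm_mul, hu1, mul_one, Complex.norm_real, Real.norm_of_nonneg h₁.le]
  have hn₂ : ‖-((ρ₂ : ℂ) * u)‖ = ρ₂ := by
    rw [norm_neg, norm_mul, hu1, mul_one, Complex.norm_real, Real.norm_of_nonneg h₂.le]
  have hv₁ : (ρ₁ : ℂ) * u ≠ 0 := norm_pos_iff.1 (by rwa [hn₁])
  have hv₂ : -((ρ₂ : ℂ) * u) ≠ 0 := norm_pos_iff.1 (by rwa [hn₂])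
  have hmp₁ := MeasureTheory.measurePreserving_add_left
    (MeasureTheory.volume : MeasureTheory.Measure ℝ) s₀
  have hmp₂ := MeasureTheory.Measure.measurePreserving_sub_left
    (MeasureTheory.volume : MeasureTheory.Measure ℝ) s₀
  have lim₁ := tendsto_integral_indicator_sub_integral (δ := 1 / 2) (M := M)
    (h := fun x => γ (s₀ + x) - γ s₀)
    (G := fun x => 1 / (γ (s₀ + x) - γ s₀) * deriv γ (s₀ + x)) (by norm_num)
    ((hγ.continuous.comp (continuous_const.add continuous_id)).sub continuous_const)
    (fun x hx => hne x hx.1.ne' (by rw [abs_of_pos hx.1]; exact hx.2)) (by simp) hgerm₁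
    hv₁ (hmeas.comp_measurePreserving hmp₁) hM0
    (hmp₁.quasiMeasurePreserving.ae hbound)
  have lim₂ := tendsto_integral_indicator_sub_integral (δ := 1 / 2) (M := M)
    (h := fun x => γ (s₀ - x) - γ s₀)
    (G := fun x => 1 / (γ (s₀ - x) - γ s₀) * deriv γ (s₀ - x)) (by norm_num)
    ((hγ.continuous.comp (continuous_const.sub continuous_id)).sub continuous_const)
    (fun x hx => by
      have := hne (-x) (neg_ne_zero.2 hx.1.ne') (by rw [abs_neg, abs_of_pos hx.1]; exact hx.2)
      rwa [← sub_eq_add_neg] at this) (by simp) hgerm₂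
    hv₂ (hmeas.comp_measurePreserving hmp₂) hM0
    (hmp₂.quasiMeasurePreserving.ae hbound)
  rw [hn₁] at lim₁
  rw [hn₂] at lim₂
  have q₁ := tendsto_germ_div (h := fun x => γ (s₀ + x) - γ s₀) (by simp) hu h₁ hgerm₁
  have q₂ := tendsto_germ_div (h := fun x => γ (s₀ - x) - γ s₀) (u := -u) (by simp)
    (neg_ne_zero.2 hu) h₂ (by rwa [mul_neg])
  have l₁ := (q₁.const_mul Complex.I).clog (by simp [Complex.mem_slitPlane_iff])
  have l₂ := (q₂.const_mul (-Complex.I)).clog (by simp [Complex.mem_slitPlane_iff])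
  rw [mul_one, Complex.log_I] at l₁
  rw [mul_one, Complex.log_neg_I] at l₂
  -- The truncation errors vanish, and the logarithms tend to `log i` and `log (-i)`, leaving `2πi -
  -- πi`.
  have total := (lim₁.add lim₂).add ((tendsto_const_nhds (x := 2 * Real.pi * Complex.I)).sub
    (l₁.sub l₂))
  rw [show (0 : ℂ) + 0 + (2 * Real.pi * Complex.I - (Real.pi / 2 * Complex.I -
    -(Real.pi / 2) * Complex.I)) = Real.pi * Complex.I by ring] at total
  refine total.congr' ?_
  have hev : ∀ᶠ ε in 𝓝[>] (0 : ℝ), ε < min (ρ₁ * δ) (ρ₂ * δ) :=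
    nhdsWithin_le_nhds (Iio_mem_nhds (by positivity))
  filter_upwards [hev, self_mem_nhdsWithin] with ε hε hε0
  rw [mem_Ioi] at hε0
  have hb : ε / ρ₁ ≤ δ := by
    rw [div_le_iff₀ h₁, mul_comm]; exact (hε.trans_le (min_le_left _ _)).le
  have ha : ε / ρ₂ ≤ δ := by
    rw [div_le_iff₀ h₂, mul_comm]; exact (hε.trans_le (min_le_right _ _)).le
  have hb0 : 0 < ε / ρ₁ := by positivity
  have ha0 : 0 < ε / ρ₂ := by positivity
  -- The parameter cuts `ε / ρ₁` and `ε / ρ₂` compensate for unequal one-sided speeds: both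
  -- endpoints lie at distance asymptotic to `ε`. After division by `ε` the two terms `log ε`
  -- cancel.
  have hjump := (hγ.jump hpos ha0 hb0 (by linarith) hu (fun x hx => hr x ⟨hx.1, hx.2.trans hb⟩)
    (fun x hx => hl x ⟨hx.1, hx.2.trans ha⟩)).1
  have hε' : (ε : ℂ) ≠ 0 := Complex.ofReal_ne_zero.2 hε0.ne'
  have hlog : ∀ w : ℂ, w ≠ 0 → Complex.log w = Real.log ε + Complex.log (w / ε) := fun w hw => by
    rw [← Complex.log_ofReal_mul hε0 (div_ne_zero hw hε'), mul_div_cancel₀ _ hε']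
  have w₁ : Complex.I * ((γ (s₀ + ε / ρ₁) - γ s₀) / u) ≠ 0 := fun h => by
    have := hr _ ⟨hb0, hb⟩
    rw [(mul_eq_zero.1 h).resolve_left Complex.I_ne_zero] at this
    exact lt_irrefl _ this
  have w₂ : Complex.I * ((γ (s₀ - ε / ρ₂) - γ s₀) / u) ≠ 0 := fun h => by
    have := hl _ ⟨ha0, ha⟩
    rw [(mul_eq_zero.1 h).resolve_left Complex.I_ne_zero] at this
    exact lt_irrefl _ this
  rw [hlog _ w₁, hlog _ w₂, hγ.integral_arc_split ha0 hb0 (ha.trans hδ2) (hb.trans hδ2)] at hjump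
  rw [hγ.integral_indicator_split s₀ hε0, ← hjump]
  have r₁ : Complex.I * ((γ (s₀ + ε / ρ₁) - γ s₀) / u) / ε =
      Complex.I * ((γ (s₀ + ε / ρ₁) - γ s₀) / u / ε) := by ring
  have r₂ : Complex.I * ((γ (s₀ - ε / ρ₂) - γ s₀) / u) / ε =
      -Complex.I * ((γ (s₀ - ε / ρ₂) - γ s₀) / -u / ε) := by
    rw [div_neg]; ring
  rw [r₁, r₂]
  ring

/-- Off `z₀`, `f t / (t - z₀)` is `dslope f z₀ t + f z₀ / (t - z₀)`. The truncated integrals of the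
first term tend to its full integral, `0`, by dominated convergence; the second is the case of a
constant. -/
theorem IsContour.hasPrincipalValue (hγ : IsContour γ) (hpos : PositivelyOriented γ)
    (hU : IsOpen U) (hsub : inside γ ∪ trace γ ⊆ U) (hf : DifferentiableOn ℂ f U) {s₀ : ℝ}
    (hs : HasTangentAt γ s₀) :
    HasPrincipalValue γ f (γ s₀) (Real.pi * Complex.I * f (γ s₀)) := by
  have htr : trace γ ⊆ U := subset_union_right.trans hsub
  have hz : γ s₀ ∈ U := htr (hγ.mem_trace s₀)
  have hdc : ContinuousOn (dslope f (γ s₀)) (trace γ) :=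
    (continuousOn_dslope_of_isOpen hU hf hz).mono htr
  have hcont : Continuous fun s => dslope f (γ s₀) (γ s) :=
    hdc.comp_continuous hγ.continuous hγ.mem_trace
  have hset : ∀ ε : ℝ, MeasurableSet {s | ε < ‖γ s - γ s₀‖} := fun ε =>
    (isOpen_lt continuous_const (hγ.continuous.sub continuous_const).norm).measurableSet
  have hint : IntervalIntegrable (fun s => dslope f (γ s₀) (γ s) * deriv γ s)
      MeasureTheory.volume 0 1 := hγ.intervalIntegrable_mul_deriv hcont.continuousOn
  have lim₁ : Tendsto (fun ε : ℝ => ∫ s in (0 : ℝ)..1, {s : ℝ | ε < ‖γ s - γ s₀‖}.indicator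
      (fun s => dslope f (γ s₀) (γ s) * deriv γ s) s) (𝓝[>] 0) (𝓝 0) := by
    have h0 := (hγ.contourIntegral_dslope_eq_zero hU hsub hf).1 _ hz
    rw [← h0]
    refine intervalIntegral.tendsto_integral_filter_of_dominated_convergence
      (fun s => ‖dslope f (γ s₀) (γ s) * deriv γ s‖) (Eventually.of_forall fun ε => ?_)
      (Eventually.of_forall fun ε => Eventually.of_forall fun s _ => ?_) hint.norm ?_
    · exact hint.aestronglyMeasurable_restrict_uIoc.indicator (hset ε)
    · exact norm_indicator_le_norm_self (fun s => dslope f (γ s₀) (γ s) * deriv γ s) s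
    · have hS : (range fun n : ℤ => s₀ + n).Countable := countable_range _
      filter_upwards [hS.ae_notMem MeasureTheory.volume] with s hs' _
      have hne : γ s ≠ γ s₀ := fun h => by
        obtain ⟨n, hn⟩ := hγ.eq_add_int h
        exact hs' ⟨n, hn.symm⟩
      refine tendsto_const_nhds.congr' ?_
      filter_upwards [nhdsWithin_le_nhds (Iio_mem_nhds (norm_pos_iff.2 (sub_ne_zero.2 hne)))]
        with ε hε
      exact (indicator_of_mem (show s ∈ {s | ε < ‖γ s - γ s₀‖} from hε)
        (fun s => dslope f (γ s₀) (γ s) * deriv γ s)).symm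
  have lim₂ := Tendsto.const_mul (f (γ s₀)) (hγ.hasPrincipalValue_one hpos hs)
  have lim := lim₁.add lim₂
  rw [zero_add, mul_comm] at lim
  refine lim.congr' ?_
  filter_upwards [self_mem_nhdsWithin] with ε hε
  rw [mem_Ioi] at hε
  rw [← intervalIntegral.integral_const_mul, ← intervalIntegral.integral_add]
  · congr 1
    ext s
    by_cases h : ε < ‖γ s - γ s₀‖
    · have hmem : s ∈ {s | ε < ‖γ s - γ s₀‖} := h
      have hne : γ s - γ s₀ ≠ 0 := norm_pos_iff.1 (hε.trans h)
      simp only [indicator_of_mem hmem]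
      rw [dslope_of_ne _ (sub_ne_zero.1 hne), slope_def_field]
      field_simp
      ring
    · have hmem : s ∉ {s | ε < ‖γ s - γ s₀‖} := h
      simp only [indicator_of_notMem hmem, mul_zero, add_zero]
  · rw [intervalIntegrable_iff] at hint ⊢
    exact hint.indicator (hset ε)
  · exact (hγ.intervalIntegrable_indicator (g := fun _ => 1) continuousOn_const _ hε 0 1).const_mul _

end CauchyContour

/-! ### The theorem -/

theorem theorem9 (γ : ℝ → ℂ) (hγ : CauchyContour.IsContour γ)
    (hpos : CauchyContour.PositivelyOriented γ)
    (U : Set ℂ) (hU : IsOpen U)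
    (hsub : CauchyContour.inside γ ∪ CauchyContour.trace γ ⊆ U)
    (f : ℂ → ℂ) (hf : DifferentiableOn ℂ f U) :
    -- the closed domains are the domains together with the contour
    closure (CauchyContour.inside γ) = CauchyContour.inside γ ∪ CauchyContour.trace γ ∧
    closure (CauchyContour.outside γ) = CauchyContour.outside γ ∪ CauchyContour.trace γ ∧
    ∀ n : ℕ,
      -- the derivatives of the Cauchy integral exist off the contour, with their integral formulas
      (∀ z ∉ CauchyContour.trace γ, AnalyticAt ℂ (CauchyContour.cauchyJ γ f) z ∧
        ∀ m ≤ n, CauchyContour.cauchyJn γ f n z = CauchyContour.cauchyJnm γ f n m z) ∧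
      -- the identities in the open domains, the point at infinity included
      (∀ z ∈ CauchyContour.inside γ,
        CauchyContour.cauchyJn γ f n z - iteratedDeriv n f z = 0) ∧
      (∀ z ∈ CauchyContour.outside γ, CauchyContour.cauchyJn γ f n z = 0) ∧
      Tendsto (CauchyContour.cauchyJn γ f n) (Bornology.cobounded ℂ) (𝓝 0) ∧
      -- uniform convergence up to the contour, from inside and from outside
      CauchyContour.ConvergesUniformlyUpTo (CauchyContour.inside γ) (CauchyContour.trace γ)
        (CauchyContour.cauchyJn γ f n) (iteratedDeriv n f) ∧
      CauchyContour.ConvergesUniformlyUpTo (CauchyContour.inside γ) (CauchyContour.trace γ)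
        (fun z => CauchyContour.cauchyJn γ f n z - iteratedDeriv n f z) (fun _ => 0) ∧
      CauchyContour.ConvergesUniformlyUpTo (CauchyContour.outside γ) (CauchyContour.trace γ)
        (CauchyContour.cauchyJn γ f n) (fun _ => 0) ∧
      -- the common boundary value at the regular points of the contour
      ∀ s : ℝ, CauchyContour.HasTangentAt γ s →
        ∃ P : ℂ, CauchyContour.HasPrincipalValue γ (iteratedDeriv n f) (γ s) P ∧
          Tendsto (fun z => CauchyContour.cauchyJn γ f n z - iteratedDeriv n f z)
            (𝓝[CauchyContour.inside γ] (γ s))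
            (𝓝 (-(1 / 2) * iteratedDeriv n f (γ s) + 1 / (2 * Real.pi * Complex.I) * P)) ∧
          Tendsto (CauchyContour.cauchyJn γ f n) (𝓝[CauchyContour.outside γ] (γ s))
            (𝓝 (-(1 / 2) * iteratedDeriv n f (γ s) + 1 / (2 * Real.pi * Complex.I) * P)) ∧
          -(1 / 2) * iteratedDeriv n f (γ s) + 1 / (2 * Real.pi * Complex.I) * P = 0 := by
  have hcont : ∀ n, ContinuousOn (iteratedDeriv n f)
      (CauchyContour.inside γ ∪ CauchyContour.trace γ) :=
    fun n => (hf.iteratedDeriv_of_isOpen hU n).continuousOn.mono hsub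
  have hin := fun n z hz =>
    CauchyContour.IsContour.cauchyJn_of_mem_inside hγ hpos hU hsub hf n (z := z) hz
  have hout := fun n z hz =>
    CauchyContour.IsContour.cauchyJn_of_mem_outside hγ hU hsub hf n (z := z) hz
  refine ⟨hγ.closure_inside hpos, hγ.closure_outside hpos, fun n => ⟨fun z hz =>
    ⟨hγ.analyticAt_cauchyJ (hf.continuousOn.mono (subset_union_right.trans hsub)) hz,
      fun m hm => hγ.cauchyJn_eq_cauchyJnm hpos hU hsub hf hm hz⟩,
    fun z hz => sub_eq_zero.2 (hin n z hz), hout n, hγ.tendsto_cauchyJn_cobounded hU hsub hf n,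
    (hγ.convergesUniformlyUpTo (hcont n)).congr (hin n),
    (CauchyContour.convergesUniformlyUpTo_const _ _ 0).congr
      fun z hz => sub_eq_zero.2 (hin n z hz),
    (CauchyContour.convergesUniformlyUpTo_const _ _ 0).congr (hout n), fun s hs => ?_⟩⟩
  have hval : -(1 / 2) * iteratedDeriv n f (γ s) + 1 / (2 * Real.pi * Complex.I) *
      (Real.pi * Complex.I * iteratedDeriv n f (γ s)) = 0 := by
    have : (Real.pi : ℂ) ≠ 0 := Complex.ofReal_ne_zero.2 Real.pi_ne_zero
    field_simp
    ring
  refine ⟨_, hγ.hasPrincipalValue hpos hU hsub (hf.iteratedDeriv_of_isOpen hU n) hs, ?_, ?_, hval⟩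
  · rw [hval]
    refine tendsto_const_nhds.congr' ?_
    filter_upwards [self_mem_nhdsWithin] with z hz using (sub_eq_zero.2 (hin n z hz)).symm
  · rw [hval]
    refine tendsto_const_nhds.congr' ?_
    filter_upwards [self_mem_nhdsWithin] with z hz using (hout n z hz).symm
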